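/- Let $\alpha\in(1,2)$. Consider a single round of a two-party protocol. It has finite input alphabets $\mathcal X,\mathcal Y$, finite output alphabets $\mathcal A,\mathcal B$, a test/key bit $t\in\{0,1\}$, a joint distribution $\operatorname{P}(x,y,t)$ of inputs and bit, and a function $f$ into a finite alphabet giving the test data $\bar c=f(a,b,x,y,t)$. For each $x$ (resp. $y$) let $\{M_{a|x}\}_a$ (resp. $\{N_{b|y}\}_b$) be a POVM on the finite-dimensional space $Q_A$ (resp. $Q_B$), and let $\sigma_{Q_AQ_BE}$ be a normalized state on finite-dimensional $Q_A\otimes Q_B\otimes E$. Put $$\mathcal M(\sigma)_{A\bar CE|x,y,t}=\sum_{a,b}|a,\bar c\rangle\langle a,\bar c|\otimes \operatorname{Tr}_{Q_AQ_B}\big[(M_{a|x}\otimes N_{b|y}\otimes \mathbb 1_E)\sigma\big],\qquad \bar c=f(a,b,x,y,t),$$ $$\mathcal M(\sigma)_{A\bar CXYTE}=\sum_{x,y,t}\operatorname{P}(x,y,t)\,\mathcal M(\sigma)_{A\bar CE|x,y,t}\otimes|x,y,t\rangle\langle x,y,t|.$$ The subscript $\wedge\bar c$ denotes the (unnormalized)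 block at $\bar C=\bar c$, omitted registers are traced out, negative powers are taken on the support, and $\operatorname{P}(\bar c|x,y,t)$, $\operatorname{P}(a|\bar c,x,y,t)$ are the probabilities induced by the measurements on $\sigma$. Let $$p(\bar c)=\operatorname{Tr}\big[\mathcal M(\sigma)_{AXYTE\wedge\bar c}^{\alpha}\cdot \mathbb 1_A\otimes\mathcal M(\sigma)_{XYTE}^{1-\alpha}\big].$$ (i) For every value $\bar c$, $$p(\bar c)=\sum_{x,y,t:\ \operatorname{P}(\bar c|x,y,t)>0}\operatorname{P}(x,y,t)\operatorname{Tr}\big[\mathcal M(\sigma)_{AE\wedge\bar c|x,y,t}^{\alpha}\cdot \mathbb 1_A\otimes\mathcal M(\sigma)_E^{1-\alpha}\big].$$ (ii) For every $m\in\mathbb N$ there are nodes $t_1,\dots,t_m\in(0,1]$ and weights $w_1,\dots,w_m>0$, depending only on $\alpha$ and $m$, such that for all such rounds, all $\bar c$ and all $x,y,t$, the trace $\operatorname{Tr}\big[\mathcal M(\sigma)_{AE\wedge\bar c|x,y,t}^{\alpha}\cdot \mathbb 1_A\otimes\mathcal M(\sigma)_E^{1-\alpha}\big]$ is at most the (finite)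 supremum $$\sup_{Z_{a,i}^{x,y,t}}\ \sum_{a:\ \operatorname{P}(a|\bar c,x,y,t)>0}\operatorname{Tr}\Big[\sigma\Big(\sum_{b:\ f(a,b,x,y,t)=\bar c}M_{a|x}\otimes N_{b|y}\otimes P(Z_{a,1}^{x,y,t},\dots,Z_{a,m}^{x,y,t})+\mathbb 1_{Q_AQ_B}\otimes Q(Z_{a,1}^{x,y,t},\dots,Z_{a,m}^{x,y,t})\Big)\Big]$$ over all families of operators $Z_{a,i}^{x,y,t}$ acting on $E$, where $$P(Z_1,\dots,Z_m)=\mathbb 1+\frac{\sin(\alpha\pi)}{\pi}\sum_{i=1}^m\frac{w_i}{t_i}\big(\mathbb 1+Z_i+Z_i^\dagger+(1-t_i)Z_i^\dagger Z_i\big),\qquad Q(Z_1,\dots,Z_m)=\frac{\sin(\alpha\pi)}{\pi}\sum_{i=1}^m w_iZ_iZ_i^\dagger .$$ (If $\operatorname{P}(\bar c|x,y,t)=0$, both the trace and the empty sum are $0$.) -/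

import Mathlib

open scoped Kronecker Matrix ComplexOrder

noncomputable section

namespace RenyiDI

/-- Real power `ρ ^ s` of a positive semidefinite matrix, by functional calculus on its eigenvalues.
For `s < 0` the power is taken on the support of `ρ`, since `(0 : ℝ) ^ s = 0` for `s ≠ 0`. -/
def mpow {n : Type*} [Fintype n] [DecidableEq n] (ρ : Matrix n n ℂ) (s : ℝ) : Matrix n n ℂ :=
  cfc (fun r : ℝ => r ^ s) ρ

/-- The partial trace `Tr_{Q_A Q_B}` of an operator on `Q_A ⊗ Q_B ⊗ E`. -/
def ptraceAB {qA qB e : Type*} [Fintype qA] [Fintype qB]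
    (S : Matrix (qA × qB × e) (qA × qB × e) ℂ) : Matrix e e ℂ :=
  Matrix.of fun k k' => ∑ i, ∑ j, S (i, j, k) (i, j, k')

/-- A POVM with outcomes in `O`. -/
structure IsPOVM {O n : Type*} [Fintype O] [Fintype n] [DecidableEq n]
    (M : O → Matrix n n ℂ) : Prop where
  posSemidef : ∀ o, (M o).PosSemidef
  sum_eq_one : ∑ o, M o = 1

/-- The data of a single round. `X`, `Y` are the input alphabets, `A`, `B` the output alphabets
(outcomes that do not occur for a given input have zero POVM element), `C` the alphabet of the test
data, `T ∈ {0, 1}` the key/test bit, and `ℂ^qA`, `ℂ^qB`, `ℂ^e` the spaces of `Q_A`, `Q_B`, `E`. -/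
structure SingleRound (X Y A B C qA qB e : Type*) [Fintype X] [Fintype Y] [Fintype A] [Fintype B]
    [Fintype qA] [Fintype qB] [Fintype e] [DecidableEq qA] [DecidableEq qB] where
  /-- `P(X = x, Y = y, T = t)` -/
  P : X → Y → Fin 2 → ℝ
  P_nonneg : ∀ x y t, 0 ≤ P x y t
  P_sum : ∑ x, ∑ y, ∑ t, P x y t = 1
  /-- the test data as a function `f(a, b, x, y, t)` -/
  f : A → B → X → Y → Fin 2 → C
  /-- Alice's measurements: `M x a` is `M_{a|x}` -/
  M : X → A → Matrix qA qA ℂ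
  M_povm : ∀ x, IsPOVM (M x)
  /-- Bob's measurements: `N y b` is `N_{b|y}` -/
  N : Y → B → Matrix qB qB ℂ
  N_povm : ∀ y, IsPOVM (N y)
  /-- the state `σ` on `Q_A ⊗ Q_B ⊗ E` -/
  σ : Matrix (qA × qB × e) (qA × qB × e) ℂ
  σ_posSemidef : σ.PosSemidef
  σ_trace : σ.trace = 1

namespace SingleRound

variable {X Y A B C qA qB e : Type*} [Fintype X] [Fintype Y] [Fintype A] [Fintype B] [Fintype C]
  [Fintype qA] [Fintype qB] [Fintype e] [DecidableEq X] [DecidableEq Y] [DecidableEq A]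
  [DecidableEq C] [DecidableEq qA] [DecidableEq qB] [DecidableEq e]

/-- `M(σ)_{A C̄ E | X=x, Y=y, T=t}`, that is
`∑_{a,b} |a,c̄⟩⟨a,c̄| ⊗ Tr_{Q_A Q_B}[(M_{a|x} ⊗ N_{b|y} ⊗ 1) σ]` with `c̄ = f(a,b,x,y,t)`. -/
def condOut (R : SingleRound X Y A B C qA qB e) (x : X) (y : Y) (t : Fin 2) :
    Matrix (A × C × e) (A × C × e) ℂ :=
  ∑ a, ∑ b, Matrix.single a a (1 : ℂ) ⊗ₖ
    (Matrix.single (R.f a b x y t) (R.f a b x y t) (1 : ℂ) ⊗ₖ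
      ptraceAB ((R.M x a ⊗ₖ (R.N y b ⊗ₖ (1 : Matrix e e ℂ))) * R.σ))

/-- The output `M(σ)_{A C̄ X Y T E}` of the round, that is
`∑_{x,y,t} P(x,y,t) M(σ)_{A C̄ E | x,y,t} ⊗ |x,y,t⟩⟨x,y,t|`. -/
def out (R : SingleRound X Y A B C qA qB e) :
    Matrix ((A × C × e) × (X × Y × Fin 2)) ((A × C × e) × (X × Y × Fin 2)) ℂ :=
  ∑ x, ∑ y, ∑ t, (R.P x y t) •
    (R.condOut x y t ⊗ₖ Matrix.single (x, y, t) (x, y, t) (1 : ℂ))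

/-- The partial state `M(σ)_{A X Y T E ∧ c̄}`: the block of `M(σ)_{A C̄ X Y T E}` at `C̄ = c`. -/
def outTest (R : SingleRound X Y A B C qA qB e) (c : C) :
    Matrix (A × e × (X × Y × Fin 2)) (A × e × (X × Y × Fin 2)) ℂ :=
  Matrix.of fun i j => R.out ((i.1, c, i.2.1), i.2.2) ((j.1, c, j.2.1), j.2.2)

/-- The marginal `M(σ)_{X Y T E}`. -/
def outXYTE (R : SingleRound X Y A B C qA qB e) :
    Matrix (e × (X × Y × Fin 2)) (e × (X × Y × Fin 2)) ℂ :=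
  Matrix.of fun i j => ∑ a, ∑ c, R.out ((a, c, i.1), i.2) ((a, c, j.1), j.2)

/-- The marginal `M(σ)_E`. -/
def outE (R : SingleRound X Y A B C qA qB e) : Matrix e e ℂ :=
  Matrix.of fun k k' => ∑ a, ∑ c, ∑ v, R.out ((a, c, k), v) ((a, c, k'), v)

/-- The partial state `M(σ)_{A E ∧ c̄ | X=x, Y=y, T=t}`. -/
def condTest (R : SingleRound X Y A B C qA qB e) (c : C) (x : X) (y : Y) (t : Fin 2) :
    Matrix (A × e) (A × e) ℂ :=
  Matrix.of fun i j => R.condOut x y t (i.1, c, i.2) (j.1, c, j.2)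

/-- `p(c̄) = Tr[M(σ)_{A X Y T E ∧ c̄}^α · 1_A ⊗ M(σ)_{X Y T E}^{1-α}]`. -/
def p (R : SingleRound X Y A B C qA qB e) (α : ℝ) (c : C) : ℂ :=
  (mpow (R.outTest c) α * ((1 : Matrix A A ℂ) ⊗ₖ mpow R.outXYTE (1 - α))).trace

/-- `Tr[M(σ)_{A E ∧ c̄ | x,y,t}^α · 1_A ⊗ M(σ)_E^{1-α}]`. -/
def condTerm (R : SingleRound X Y A B C qA qB e) (α : ℝ) (c : C) (x : X) (y : Y) (t : Fin 2) : ℂ :=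
  (mpow (R.condTest c x y t) α * ((1 : Matrix A A ℂ) ⊗ₖ mpow R.outE (1 - α))).trace

/-- The outcome probability `P(a, b | x, y)` given by the Born rule. -/
def born (R : SingleRound X Y A B C qA qB e) (a : A) (b : B) (x : X) (y : Y) : ℝ :=
  (((R.M x a ⊗ₖ (R.N y b ⊗ₖ (1 : Matrix e e ℂ))) * R.σ).trace).re

/-- `P(a, c̄ | x, y, t)`. -/
def probAC (R : SingleRound X Y A B C qA qB e) (a : A) (c : C) (x : X) (y : Y) (t : Fin 2) : ℝ :=
  ∑ b with R.f a b x y t = c, R.born a b x y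

/-- `P(c̄ | x, y, t)`. -/
def probC (R : SingleRound X Y A B C qA qB e) (c : C) (x : X) (y : Y) (t : Fin 2) : ℝ :=
  ∑ a, R.probAC a c x y t

/-- `P(a | c̄, x, y, t)` (equal to `0` when `P(c̄ | x, y, t) = 0`). -/
def probAgivenC (R : SingleRound X Y A B C qA qB e) (a : A) (c : C) (x : X) (y : Y)
    (t : Fin 2) : ℝ :=
  R.probAC a c x y t / R.probC c x y t

end SingleRound

/-- `P(Z_1, …, Z_m) = 1 + (sin(απ)/π) ∑_i (w_i/t_i) (1 + Z_i + Z_i† + (1 - t_i) Z_i† Z_i)`. -/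
def polyP {e : Type*} [Fintype e] [DecidableEq e] (α : ℝ) {m : ℕ} (t w : Fin m → ℝ)
    (Z : Fin m → Matrix e e ℂ) : Matrix e e ℂ :=
  1 + (Real.sin (α * Real.pi) / Real.pi) •
    ∑ i, (w i / t i) • (1 + Z i + (Z i)ᴴ + (1 - t i) • ((Z i)ᴴ * Z i))

/-- `Q(Z_1, …, Z_m) = (sin(απ)/π) ∑_i w_i Z_i Z_i†`. -/
def polyQ {e : Type*} [Fintype e] (α : ℝ) {m : ℕ} (w : Fin m → ℝ)
    (Z : Fin m → Matrix e e ℂ) : Matrix e e ℂ :=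
  (Real.sin (α * Real.pi) / Real.pi) • ∑ i, w i • (Z i * (Z i)ᴴ)

/-- The objective
`∑_a Tr[σ (∑_b M_{a|x} ⊗ N_{b|y} ⊗ P(Z_{a,1}, …) + 1 ⊗ Q(Z_{a,1}, …))]`,
over `a` with `P(a | c̄, x, y, t) > 0` and, for each `a`, over `b` with `c̄ = f(a, b, x, y, t)`.
The traces are real since all operators are Hermitian. The nodes are called `s` here because `t` is
the key/test bit. -/
def SingleRound.objective {X Y A B C qA qB e : Type*} [Fintype X] [Fintype Y] [Fintype A]
    [Fintype B] [Fintype qA] [Fintype qB] [Fintype e] [DecidableEq C]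
    [DecidableEq qA] [DecidableEq qB] [DecidableEq e]
    (R : SingleRound X Y A B C qA qB e) (α : ℝ) {m : ℕ} (s w : Fin m → ℝ)
    (c : C) (x : X) (y : Y) (t : Fin 2) (Z : A → Fin m → Matrix e e ℂ) : ℝ :=
  ∑ a with 0 < R.probAgivenC a c x y t,
    ((R.σ * ((∑ b with R.f a b x y t = c, R.M x a ⊗ₖ (R.N y b ⊗ₖ polyP α s w (Z a))) +
      (1 : Matrix qA qA ℂ) ⊗ₖ ((1 : Matrix qB qB ℂ) ⊗ₖ polyQ α w (Z a)))).trace).re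

end RenyiDI

end

/-!
For `x > 0` the difference `x ^ (α - 1) - 1` is a positive multiple of the average of
`(x - 1) / ((1 - t) * x + t)` over a Beta-distributed `t`. For `x ≠ 1` the integrand is
`1 / (c - t)` with `c = x / (x - 1)` outside `[0, 1]`. The Gauss–Radau rule with fixed node `1` can
only overestimate its integral: its value is the integral of the polynomial which agrees with
`1 / (c - t)` to second order at the interior nodes and to first order at `1`, and that polynomial
majorizes `1 / (c - t)` on `[0, 1]`.

Let `ρ ≤ τ` have eigenpairs `(λ i, u i)` and `(μ j, v j)`. Then `Tr[ρ ^ α τ ^ (1 - α)]` is the sum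
of `λ i ^ α μ j ^ (1 - α)` with the weights `|⟨v j, u i⟩| ^ 2`, and the scalar bound at
`x = λ i / μ j` turns each node into the minimum over `z` of
`λ (1 + 2 z + (1 - t) z ^ 2) + t μ z ^ 2`, attained at `z = -λ / ((1 - t) λ + t μ)`. These numbers
`z i j` are the coefficients of the operators `Z` that witness (ii), applied to the blocks
`ρ = M(σ)_{E ∧ a, c̄ | x, y, t}` and to `τ = M(σ)_E`. The supremum is finite because `ρ ≤ τ` makes
every node contribute a nonpositive amount.

For (i), all operators are block diagonal in `x, y, t`, and `P ^ α * P ^ (1 - α) = P`.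
-/

noncomputable section

namespace GaussRadau

open Polynomial MeasureTheory Set

section Interpolatory

variable {K : Type*} [Field K]

/-- `q` is an orthogonal polynomial for the moment functional `M`: it is orthogonal to every
polynomial of smaller degree under the pairing `(p, r) ↦ M (p * r)`. -/
def IsOrthogonal (M : K[X] →ₗ[K] K) (q : K[X]) : Prop :=
  ∀ r : K[X], r.degree < q.degree → M (q * r) = 0

theorem exists_monic_isOrthogonal {M : K[X] →ₗ[K] K} (hM : ∀ p ≠ 0, M (p * p) ≠ 0) (n : ℕ) :
    ∃ q : K[X], q.Monic ∧ q.degree = n ∧ IsOrthogonal M q := by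
  let B : LinearMap.BilinForm K K[X] := (LinearMap.mul K K[X]).compr₂ M
  have hB : B.IsSymm := ⟨fun p q => by simp [B, mul_comm]⟩
  let W := degreeLT K n
  have : FiniteDimensional K W := Module.Finite.equiv (degreeLTEquiv K n).symm
  have hW : (B.restrict W).Nondegenerate := by
    refine (hB.restrict W).isRefl.nondegenerate_iff_separatingLeft.2 fun w hw => ?_
    by_contra hne
    exact hM w (fun h => hne (Subtype.ext h)) (hw w)
  let w := ((B.restrict W).toDual hW).symm (B (X ^ n) ∘ₗ W.subtype)
  have hwX : ∀ r : W, M ((w : K[X]) * r) = M (X ^ n * (r : K[X])) := fun r =>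
    LinearMap.BilinForm.apply_toDual_symm_apply (hB := hW) (B (X ^ n) ∘ₗ W.subtype) r
  have hw : (w : K[X]).degree < n := mem_degreeLT.1 w.2
  have hdeg : (X ^ n - (w : K[X])).degree = (n : WithBot ℕ) := by
    rw [degree_sub_eq_left_of_degree_lt (by rwa [degree_X_pow]), degree_X_pow]
  refine ⟨X ^ n - (w : K[X]), monic_X_pow_sub hw, hdeg, fun r hr => ?_⟩
  rw [sub_mul, map_sub, hwX ⟨r, mem_degreeLT.2 (hdeg ▸ hr)⟩, sub_self]

theorem apply_eq_sum_basis [DecidableEq K] {L : K[X] →ₗ[K] K} {S : Finset K} {k : ℕ}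
    (hL : ∀ d : K[X], d.degree < k → L (Lagrange.nodal S id * d) = 0)
    {p : K[X]} (hp : p.degree < S.card + k) :
    L p = ∑ r ∈ S, L (Lagrange.basis S id r) * p.eval r := by
  have hN : (Lagrange.nodal S (id : K → K)).Monic := Lagrange.nodal_monic
  set N : K[X] := Lagrange.nodal S id
  have hquot : (p /ₘ N).degree < k := by
    by_cases h : N.degree ≤ p.degree
    · have := degree_add_divByMonic hN h
      rw [Lagrange.degree_nodal] at this
      rw [← this] at hp
      exact (WithBot.add_lt_add_iff_left (by simp)).1 hp
    · rw [(divByMonic_eq_zero_iff hN).2 (not_le.1 h), degree_zero]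
      exact WithBot.bot_lt_coe k
  have hrem : (p %ₘ N).degree < S.card :=
    Lagrange.degree_nodal (v := (id : K → K)) ▸ degree_modByMonic_lt p hN
  have heval : ∀ r ∈ S, (p %ₘ N).eval r = p.eval r := fun r hr =>
    eval₂_modByMonic_eq_self_of_root (f := RingHom.id K)
      (Lagrange.eval_nodal_at_node (v := id) hr)
  calc L p = L (p %ₘ N) := by
        conv_lhs => rw [← modByMonic_add_div p N, map_add, hL _ hquot, add_zero]
    _ = L (∑ r ∈ S, C (p.eval r) * Lagrange.basis S id r) := by
        rw [Lagrange.eq_interpolate_of_eval_eq (v := id) (fun r => p.eval r)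
          Function.injective_id.injOn hrem heval, Lagrange.interpolate_apply]
    _ = ∑ r ∈ S, L (Lagrange.basis S id r) * p.eval r := by
        simp only [map_sum, ← smul_eq_C_mul, map_smul, smul_eq_mul, mul_comm (L _)]

theorem exists_eval_eq_inv_sub_mul {N : K[X]} {c : K} (hN : N.eval c ≠ 0) :
    ∃ p : K[X], p.natDegree ≤ N.natDegree - 1 ∧
      ∀ t ≠ c, p.eval t = (c - t)⁻¹ * (1 - N.eval t / N.eval c) := by
  obtain ⟨D, hD⟩ : X - C c ∣ N - C (N.eval c) := X_sub_C_dvd_sub_C_eval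
  refine ⟨C (N.eval c)⁻¹ * D, (natDegree_C_mul_le _ _).trans ?_, fun t ht => ?_⟩
  · rcases eq_or_ne D 0 with rfl | hD0
    · simp
    have hdeg := natDegree_mul (X_sub_C_ne_zero c) hD0
    rw [← hD, natDegree_X_sub_C, natDegree_sub_C] at hdeg
    omega
  · have hDt := congrArg (eval t) hD
    simp only [eval_sub, eval_mul, eval_X, eval_C] at hDt ⊢
    have := sub_ne_zero.2 ht.symm
    field_simp
    linear_combination hDt

end Interpolatory

section Roots

variable {a b : ℝ} {M : ℝ[X] →ₗ[ℝ] ℝ} {q : ℝ[X]}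

/-- The functional is positive on `(a, b)`, as integration against a positive measure on `(a, b)`
with infinite support is. -/
def IsPositiveOn (a b : ℝ) (M : ℝ[X] →ₗ[ℝ] ℝ) : Prop :=
  ∀ p : ℝ[X], p ≠ 0 → (∀ t ∈ Ioo a b, 0 ≤ p.eval t) → 0 < M p

theorem IsPositiveOn.apply_mul_self_pos (hM : IsPositiveOn a b M) {p : ℝ[X]} (hp : p ≠ 0) :
    0 < M (p * p) :=
  hM _ (mul_self_ne_zero.2 hp) fun t _ => by rw [eval_mul]; exact mul_self_nonneg _

theorem IsPositiveOn.comp_mulLeft (hM : IsPositiveOn a b M) {h : ℝ[X]} (hh : h ≠ 0)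
    (hpos : ∀ t ∈ Ioo a b, 0 ≤ h.eval t) : IsPositiveOn a b (M ∘ₗ LinearMap.mulLeft ℝ h) :=
  fun p hp hp0 => hM _ (mul_ne_zero hh hp) fun t ht => by
    rw [LinearMap.mulLeft_apply, eval_mul]; exact mul_nonneg (hpos t ht) (hp0 t ht)

theorem IsOrthogonal.exists_eval_neg_of_mul (hM : IsPositiveOn a b M) (hq : q ≠ 0)
    (ho : IsOrthogonal M q) {h g : ℝ[X]} (hqe : q = h * g) (hh : 0 < h.degree) :
    ∃ t ∈ Ioo a b, h.eval t < 0 := by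
  by_contra! hpos
  obtain ⟨hh0, hg0⟩ := mul_ne_zero_iff.1 (hqe ▸ hq)
  have hdeg : g.degree < q.degree := by
    rw [hqe, degree_mul, degree_eq_natDegree hg0, degree_eq_natDegree hh0] at *
    exact_mod_cast lt_add_of_pos_left _ (Nat.cast_pos.1 hh)
  refine (hM.comp_mulLeft hh0 hpos).apply_mul_self_pos hg0 |>.ne' ?_
  rw [LinearMap.comp_apply, LinearMap.mulLeft_apply, ← mul_assoc, ← hqe]
  exact ho g hdeg

theorem IsOrthogonal.mem_Ioo_of_isRoot (hM : IsPositiveOn a b M) (hq : q ≠ 0)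
    (ho : IsOrthogonal M q) {r : ℝ} (hr : q.IsRoot r) : r ∈ Ioo a b := by
  obtain ⟨g, hg⟩ := dvd_iff_isRoot.2 hr
  obtain ⟨t, ht, htr⟩ := ho.exists_eval_neg_of_mul hM hq hg (by simp)
  obtain ⟨u, hu, hur⟩ := ho.exists_eval_neg_of_mul hM hq (h := -(X - C r)) (g := -g)
    (by rw [hg, neg_mul_neg]) (by rw [degree_neg]; simp)
  simp only [eval_neg, eval_sub, eval_X, eval_C] at htr hur
  exact ⟨by linarith [ht.1], by linarith [hu.2]⟩

theorem IsOrthogonal.nodup_roots (hM : IsPositiveOn a b M) (hq : q ≠ 0)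
    (ho : IsOrthogonal M q) : q.roots.Nodup := by
  refine Multiset.nodup_iff_count_le_one.2 fun r => ?_
  rw [count_roots]
  by_contra! h
  obtain ⟨g, hg⟩ := (le_rootMultiplicity_iff hq).1 h
  obtain ⟨t, -, ht⟩ := ho.exists_eval_neg_of_mul hM hq hg (by simp)
  rw [eval_pow] at ht
  exact ht.not_ge (sq_nonneg _)

theorem IsOrthogonal.splits (hM : IsPositiveOn a b M) (hq : q ≠ 0)
    (ho : IsOrthogonal M q) : q.Splits := by
  refine (IsAlgClosed.splits (q.map (algebraMap ℝ ℂ))).of_splits_map _ fun z hz => ?_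
  have hzq : aeval z q = 0 := by
    rwa [mem_roots (map_ne_zero hq), IsRoot.def, eval_map_algebraMap] at hz
  by_cases him : z.im = 0
  · exact ⟨z.re, Complex.ext (by simp) (by simp [him])⟩
  · obtain ⟨g, hg⟩ := quadratic_dvd_of_aeval_eq_zero_im_ne_zero q hzq him
    have hd : (X ^ 2 - C (2 * z.re) * X + C (‖z‖ ^ 2) : ℝ[X]).degree = 2 := by
      compute_degree!
    obtain ⟨t, -, ht⟩ := ho.exists_eval_neg_of_mul hM hq hg (by rw [hd]; norm_num)
    have heval : (X ^ 2 - C (2 * z.re) * X + C (‖z‖ ^ 2)).eval t =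
        (t - z.re) ^ 2 + z.im ^ 2 := by
      simp only [eval_add, eval_sub, eval_mul, eval_pow, eval_X, eval_C, Complex.sq_norm,
        Complex.normSq_apply]
      ring
    exact absurd ht (heval ▸ not_lt.2 (by positivity))

theorem IsPositiveOn.exists_isOrthogonal_nodal (hM : IsPositiveOn a b M) (n : ℕ) :
    ∃ S : Finset ℝ, S.card = n ∧ (S : Set ℝ) ⊆ Ioo a b ∧
      IsOrthogonal M (Lagrange.nodal S id) := by
  obtain ⟨q, hq, hn, ho⟩ :=
    exists_monic_isOrthogonal (fun p hp => (hM.apply_mul_self_pos hp).ne') n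
  have hsplit := ho.splits hM hq.ne_zero
  have hnodup := ho.nodup_roots hM hq.ne_zero
  have hnodal : Lagrange.nodal q.roots.toFinset id = q := by
    calc Lagrange.nodal q.roots.toFinset id = (q.roots.map (X - C ·)).prod := by
          rw [Lagrange.nodal_eq, Finset.prod, Multiset.toFinset_val, hnodup.dedup]; rfl
      _ = q := (hsplit.eq_prod_roots_of_monic hq).symm
  refine ⟨q.roots.toFinset, ?_, fun r hr => ?_, hnodal.symm ▸ ho⟩
  · rw [Multiset.toFinset_card_of_nodup hnodup, ← hsplit.natDegree_eq_card_roots,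
      natDegree_eq_of_degree_eq_some hn]
  · exact ho.mem_Ioo_of_isRoot hM hq.ne_zero (isRoot_of_mem_roots (Multiset.mem_toFinset.1 hr))

end Roots

section Radau

variable {a b c : ℝ} {L : ℝ[X] →ₗ[ℝ] ℝ} {S : Finset ℝ} {w : ℝ → ℝ}

theorem C_sub_X_ne_zero : (C b - X : ℝ[X]) ≠ 0 := by
  rw [← neg_sub, neg_ne_zero]; exact X_sub_C_ne_zero b

theorem IsPositiveOn.comp_mulLeft_C_sub_X (hL : IsPositiveOn a b L) :
    IsPositiveOn a b (L ∘ₗ LinearMap.mulLeft ℝ (C b - X)) :=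
  hL.comp_mulLeft C_sub_X_ne_zero fun t ht => by
    simp only [eval_sub, eval_C, eval_X]; linarith [ht.2]

/-- Gauss–Radau exactness: the rule with weights `w` at the nodes `S` and the fixed node `b`
integrates `L` on polynomials of degree at most `2 * #S`. -/
def IsRadauRule (L : ℝ[X] →ₗ[ℝ] ℝ) (b : ℝ) (S : Finset ℝ) (w : ℝ → ℝ) : Prop :=
  ∀ p : ℝ[X], p.natDegree ≤ 2 * S.card → L p = ∑ r ∈ insert b S, w r * p.eval r

theorem IsOrthogonal.isRadauRule (hbS : b ∉ S)
    (ho : IsOrthogonal (L ∘ₗ LinearMap.mulLeft ℝ (C b - X)) (Lagrange.nodal S id)) :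
    IsRadauRule L b S fun r => L (Lagrange.basis (insert b S) id r) := by
  intro p hp
  refine apply_eq_sum_basis (k := S.card) (fun d hd => ?_) ?_
  · have h := ho d (by rwa [Lagrange.degree_nodal])
    rw [Lagrange.nodal_insert_eq_nodal hbS, id, ← neg_sub, neg_mul, neg_mul, map_neg,
      mul_assoc]
    exact neg_eq_zero.2 h
  · rw [Finset.card_insert_of_notMem hbS]
    refine (degree_le_of_natDegree_le hp).trans_lt ?_
    exact_mod_cast (by omega)

theorem IsRadauRule.weight_fixed_pos (hL : IsPositiveOn a b L) (hbS : b ∉ S)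
    (hw : IsRadauRule L b S w) : 0 < w b := by
  set q : ℝ[X] := Lagrange.nodal S id
  have hq : q.natDegree = S.card := Lagrange.natDegree_nodal
  have hqS : ∀ r ∈ S, q.eval r = 0 := fun r hr => Lagrange.eval_nodal_at_node (v := id) hr
  have hpos : 0 < L (q * q) := hL.apply_mul_self_pos Lagrange.nodal_ne_zero
  rw [hw _ (natDegree_mul_le.trans (by omega)), Finset.sum_insert hbS,
    Finset.sum_eq_zero fun r hr => by rw [eval_mul, hqS r hr, mul_zero, mul_zero], add_zero,
    eval_mul] at hpos
  exact pos_of_mul_pos_left hpos (mul_self_nonneg _)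

theorem IsRadauRule.weight_pos (hL : IsPositiveOn a b L) (hSb : ∀ r ∈ S, r < b)
    (hw : IsRadauRule L b S w) {s : ℝ} (hs : s ∈ S) : 0 < w s := by
  set g : ℝ[X] := Lagrange.nodal (S.erase s) id
  have hg : g.natDegree = S.card - 1 := by
    rw [Lagrange.natDegree_nodal, Finset.card_erase_of_mem hs]
  have hgS : ∀ r ∈ S, r ≠ s → g.eval r = 0 := fun r hr hrs =>
    Lagrange.eval_nodal_at_node (v := id) (Finset.mem_erase.2 ⟨hrs, hr⟩)
  have hpos : 0 < L ((C b - X) * (g * g)) :=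
    hL.comp_mulLeft_C_sub_X.apply_mul_self_pos Lagrange.nodal_ne_zero
  have hdeg : ((C b - X) * (g * g)).natDegree ≤ 2 * S.card := by
    have hX : (C b - X : ℝ[X]).natDegree ≤ 1 := by compute_degree
    have hgg : (g * g).natDegree ≤ g.natDegree + g.natDegree := natDegree_mul_le
    have := Finset.card_pos.2 ⟨s, hs⟩
    exact natDegree_mul_le.trans (by omega)
  rw [hw _ hdeg, Finset.sum_eq_single_of_mem s (Finset.mem_insert_of_mem hs)] at hpos
  · simp only [eval_mul, eval_sub, eval_C, eval_X] at hpos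
    exact pos_of_mul_pos_left hpos
      (mul_nonneg (sub_nonneg.2 (hSb s hs).le) (mul_self_nonneg _))
  · intro r hr hrs
    rcases Finset.mem_insert.1 hr with rfl | hr
    · simp only [eval_mul, eval_sub, eval_C, eval_X, sub_self, zero_mul, mul_zero]
    · simp only [eval_mul, hgS r hr hrs, mul_zero]

theorem IsPositiveOn.exists_isRadauRule (hL : IsPositiveOn a b L) (n : ℕ) :
    ∃ (S : Finset ℝ) (w : ℝ → ℝ), S.card = n ∧ (S : Set ℝ) ⊆ Ioo a b ∧
      (∀ r ∈ insert b S, 0 < w r) ∧ IsRadauRule L b S w := by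
  obtain ⟨S, hcard, hS, ho⟩ := hL.comp_mulLeft_C_sub_X.exists_isOrthogonal_nodal n
  have hSb : ∀ r ∈ S, r < b := fun r hr => (hS hr).2
  have hbS : b ∉ S := fun h => lt_irrefl b (hSb b h)
  have hw := ho.isRadauRule hbS
  refine ⟨S, _, hcard, hS, fun r hr => ?_, hw⟩
  rcases Finset.mem_insert.1 hr with rfl | hr
  · exact hw.weight_fixed_pos hL hbS
  · exact hw.weight_pos hL hSb hr

theorem sub_mul_sub_pos_of_notMem_Icc (hc : c ∉ Icc a b) {s t : ℝ} (hs : s ∈ Icc a b)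
    (ht : t ∈ Icc a b) : 0 < (c - s) * (c - t) := by
  rcases lt_or_ge c a with h | h
  · exact mul_pos_of_neg_of_neg (by linarith [hs.1]) (by linarith [ht.1])
  · have hbc : b < c := not_le.1 fun h' => hc ⟨h, h'⟩
    exact mul_pos (by linarith [hs.2]) (by linarith [ht.2])

/-- The majorant is the Hermite interpolant of `t ↦ (c - t)⁻¹` at the nodes of the rule. -/
theorem exists_majorant_inv_sub (hab : a ≤ b) (hS : (S : Set ℝ) ⊆ Icc a b) (hc : c ∉ Icc a b) :
    ∃ p : ℝ[X], p.natDegree ≤ 2 * S.card ∧ (∀ t ∈ Icc a b, (c - t)⁻¹ ≤ p.eval t) ∧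
      ∀ r ∈ insert b S, p.eval r = (c - r)⁻¹ := by
  have hb : b ∈ Icc a b := right_mem_Icc.2 hab
  have hct : ∀ t ∈ Icc a b, t ≠ c := fun t ht => ne_of_mem_of_not_mem ht hc
  set q : ℝ[X] := Lagrange.nodal S id
  have hNeval (t : ℝ) : ((C b - X) * (q * q)).eval t = (b - t) * (q.eval t * q.eval t) := by
    simp only [eval_mul, eval_sub, eval_C, eval_X]
  have hqc : q.eval c ≠ 0 := Lagrange.eval_nodal_not_at_node fun r hr => (hct r (hS hr)).symm
  obtain ⟨p, hdeg, hp⟩ := exists_eval_eq_inv_sub_mul (N := (C b - X) * (q * q)) (c := c) (by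
    rw [hNeval]
    exact mul_ne_zero (sub_ne_zero.2 (hct b hb)) (mul_self_ne_zero.2 hqc))
  simp only [hNeval] at hp
  refine ⟨p, ?_, fun t ht => ?_, fun r hr => ?_⟩
  · have hqdeg : q.natDegree ≤ S.card := Lagrange.natDegree_nodal.le
    have hNdeg : ((C b - X) * (q * q)).natDegree ≤ 2 * S.card + 1 := by
      compute_degree
      omega
    omega
  · have hsign : 0 ≤ (b - t) * (q.eval t * q.eval t) /
        ((c - b) * (c - t) * (q.eval c * q.eval c)) :=
      div_nonneg (mul_nonneg (sub_nonneg.2 ht.2) (mul_self_nonneg _)) (mul_nonneg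
        (sub_mul_sub_pos_of_notMem_Icc hc hb ht).le (mul_self_nonneg _))
    refine (le_add_of_nonneg_right hsign).trans_eq ?_
    rw [hp t (hct t ht)]
    have h₁ := sub_ne_zero.2 (hct t ht).symm
    have h₂ := sub_ne_zero.2 (hct b hb)
    have h₃ := sub_ne_zero.2 (hct b hb).symm
    field_simp
    ring
  · rw [hp r (hct r ((Finset.mem_insert.1 hr).elim (· ▸ hb) (hS ·)))]
    rcases Finset.mem_insert.1 hr with rfl | hr
    · rw [sub_self, zero_mul, zero_div, sub_zero, mul_one]
    · have hqr : q.eval r = 0 := Lagrange.eval_nodal_at_node (v := id) hr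
      rw [hqr, mul_zero, mul_zero, zero_div, sub_zero, mul_one]

end Radau

section Measure

variable {a b : ℝ} {μ : Measure ℝ}

theorem integrable_of_continuousOn_Icc [IsFiniteMeasure μ] {f : ℝ → ℝ}
    (hf : ContinuousOn f (Icc a b)) (hμ : ∀ᵐ t ∂μ, t ∈ Icc a b) : Integrable f μ := by
  rw [← Measure.restrict_eq_self_of_ae_mem hμ]
  exact hf.integrableOn_Icc

/-- Integration of polynomials against a measure with finite moments. -/
def momentFunctional (μ : Measure ℝ) (hμ : ∀ p : ℝ[X], Integrable (fun t => p.eval t) μ) :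
    ℝ[X] →ₗ[ℝ] ℝ where
  toFun p := ∫ t, p.eval t ∂μ
  map_add' p q := by simp only [eval_add, integral_add (hμ p) (hμ q)]
  map_smul' r p := by simp only [eval_smul, integral_smul, RingHom.id_apply]

theorem isPositiveOn_momentFunctional [NullSingletonClass μ] [NeZero μ]
    (hμ : ∀ p : ℝ[X], Integrable (fun t => p.eval t) μ) (hab : ∀ᵐ t ∂μ, t ∈ Ioo a b) :
    IsPositiveOn a b (momentFunctional μ hμ) := by
  intro p hp hpos
  have hnonneg : 0 ≤ᵐ[μ] fun t => p.eval t := hab.mono hpos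
  refine (integral_nonneg_of_ae hnonneg).lt_of_ne' fun hzero => ?_
  have hroot : ∀ᵐ t ∂μ, p.IsRoot t := (integral_eq_zero_iff_of_nonneg_ae hnonneg (hμ p)).1 hzero
  have hroots : {t | p.IsRoot t}.Finite := finite_setOfPred_isRoot hp
  have hnot : ∀ᵐ t ∂μ, ¬ p.IsRoot t := hroots.countable.ae_notMem μ
  have : ∀ᵐ _ ∂μ, False := hroot.mp (hnot.mono fun _ h h' => h h')
  exact NeZero.ne μ (ae_eq_bot.1 (Filter.eventually_false_iff_eq_bot.1 this))

theorem exists_integral_inv_sub_le_sum [IsFiniteMeasure μ] [NullSingletonClass μ] [NeZero μ]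
    (hμ : ∀ᵐ t ∂μ, t ∈ Ioo a b) (n : ℕ) :
    ∃ (S : Finset ℝ) (w : ℝ → ℝ), S.card = n ∧ (S : Set ℝ) ⊆ Ioo a b ∧
      (∀ r ∈ insert b S, 0 < w r) ∧
      ∀ c ∉ Icc a b, ∫ t, (c - t)⁻¹ ∂μ ≤ ∑ r ∈ insert b S, w r * (c - r)⁻¹ := by
  have hμ' : ∀ᵐ t ∂μ, t ∈ Icc a b := hμ.mono fun _ ht => Ioo_subset_Icc_self ht
  have hint : ∀ p : ℝ[X], Integrable (fun t => p.eval t) μ := fun p =>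
    integrable_of_continuousOn_Icc p.continuous.continuousOn hμ'
  obtain ⟨S, w, hcard, hS, hw, hexact⟩ :=
    (isPositiveOn_momentFunctional hint hμ).exists_isRadauRule n
  refine ⟨S, w, hcard, hS, hw, fun c hc => ?_⟩
  obtain ⟨t₀, ht₀⟩ := hμ'.exists
  obtain ⟨p, hdeg, hle, heq⟩ := exists_majorant_inv_sub (ht₀.1.trans ht₀.2)
    (hS.trans Ioo_subset_Icc_self) hc
  have hcont : ContinuousOn (fun t => (c - t)⁻¹) (Icc a b) :=
    (continuousOn_const.sub continuousOn_id).inv₀ fun t ht h =>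
      hc ((sub_eq_zero.1 h : c = t) ▸ ht)
  calc ∫ t, (c - t)⁻¹ ∂μ ≤ ∫ t, p.eval t ∂μ :=
        integral_mono_ae (integrable_of_continuousOn_Icc hcont hμ') (hint p) (hμ'.mono hle)
    _ = ∑ r ∈ insert b S, w r * p.eval r := hexact p hdeg
    _ = ∑ r ∈ insert b S, w r * (c - r)⁻¹ := Finset.sum_congr rfl fun r hr => by rw [heq r hr]

end Measure

section Rpow

open ProbabilityTheory

theorem ae_betaMeasure_mem_Ioo (α β : ℝ) : ∀ᵐ t ∂betaMeasure α β, t ∈ Ioo (0 : ℝ) 1 := by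
  have hmeas : Measurable (betaPDF α β) := (measurable_betaPDFReal α β).ennreal_ofReal
  refine (ae_withDensity_iff hmeas).2 (.of_forall fun t ht => ?_)
  by_contra h
  rcases not_and_or.1 h with h | h
  · exact ht (betaPDF_eq_zero_of_nonpos (not_lt.1 h))
  · exact ht (betaPDF_eq_zero_of_one_le (not_lt.1 h))

theorem integral_betaMeasure {α β : ℝ} (hα : 0 < α) (hβ : 0 < β) (g : ℝ → ℝ) :
    ∫ t, g t ∂betaMeasure α β = (beta α β)⁻¹ *
      ∫ t in Ioo 0 1, t ^ (α - 1) * (1 - t) ^ (β - 1) * g t := by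
  have hmeas : Measurable (betaPDF α β) := (measurable_betaPDFReal α β).ennreal_ofReal
  rw [← Measure.restrict_eq_self_of_ae_mem (ae_betaMeasure_mem_Ioo α β), betaMeasure,
    setIntegral_withDensity_eq_setIntegral_toReal_smul hmeas (by simp [betaPDF])
    _ measurableSet_Ioo, ← integral_const_mul]
  refine setIntegral_congr_fun measurableSet_Ioo fun t ht => ?_
  have hpos := betaPDFReal_pos ht.1 ht.2 hα hβ
  simp only [betaPDF, ENNReal.toReal_ofReal hpos.le, smul_eq_mul]
  rw [betaPDFReal, if_pos (show 0 < t ∧ t < 1 from ht)]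
  ring

theorem image_div_one_add_Ioi : (fun s : ℝ => s / (1 + s)) '' Ioi 0 = Ioo 0 1 := by
  ext t
  constructor
  · rintro ⟨s, hs, rfl⟩
    have hs : 0 < s := hs
    exact ⟨by positivity, (div_lt_one (by positivity)).2 (by linarith)⟩
  · rintro ⟨h0, h1⟩
    have h1' : 0 < 1 - t := by linarith
    exact ⟨t / (1 - t), div_pos h0 h1', by field_simp; ring⟩

theorem injOn_div_one_add_Ioi : InjOn (fun s : ℝ => s / (1 + s)) (Ioi 0) := by
  intro s hs u hu h
  have hs : 0 < s := hs
  have hu : 0 < u := hu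
  rw [div_eq_div_iff (by positivity) (by positivity)] at h
  linarith

theorem integral_Ioo_eq_integral_Ioi (g : ℝ → ℝ) :
    ∫ t in Ioo 0 1, g t = ∫ s in Ioi (0 : ℝ), 1 / (1 + s) ^ 2 * g (s / (1 + s)) := by
  have hderiv : ∀ s ∈ Ioi (0 : ℝ),
      HasDerivWithinAt (fun s : ℝ => s / (1 + s)) (1 / (1 + s) ^ 2) (Ioi 0) s := fun s hs => by
    have hs : 0 < s := hs
    have hne : 1 + s ≠ 0 := by positivity
    convert! ((hasDerivAt_id s).div ((hasDerivAt_id s).const_add 1) hne).hasDerivWithinAt using 1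
    simp
  rw [← image_div_one_add_Ioi,
    integral_image_eq_integral_abs_deriv_smul measurableSet_Ioi hderiv injOn_div_one_add_Ioi]
  refine setIntegral_congr_fun measurableSet_Ioi fun s _ => ?_
  rw [smul_eq_mul, abs_of_nonneg (by positivity)]

theorem rpowIntegrand₀₁_sub_one {β s x : ℝ} (hs : 0 < s) (hx : 0 < x) :
    Real.rpowIntegrand₀₁ β s x - Real.rpowIntegrand₀₁ β s 1 =
      1 / (1 + s) ^ 2 * ((s / (1 + s)) ^ β * (1 - s / (1 + s)) ^ (-β) *
        ((x - 1) / ((1 - s / (1 + s)) * x + s / (1 + s)))) := by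
  have h1 : 1 - s / (1 + s) = (1 + s)⁻¹ := by field_simp; ring
  have hden : (1 + s)⁻¹ * x + s / (1 + s) = (s + x) / (1 + s) := by field_simp; ring
  rw [h1, hden, Real.div_rpow hs.le (by positivity), Real.inv_rpow (by positivity),
    Real.rpow_neg (by positivity)]
  unfold Real.rpowIntegrand₀₁
  have := Real.rpow_pos_of_pos (show 0 < 1 + s by positivity) β
  field_simp
  ring

theorem exists_rpow_sub_one_eq_integral_betaMeasure {β : ℝ} (hβ : β ∈ Ioo (0 : ℝ) 1) :
    ∃ K > 0, ∀ x > 0, x ^ β - 1 =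
      K * ∫ t, (x - 1) / ((1 - t) * x + t) ∂betaMeasure (1 + β) (1 - β) := by
  set I := ∫ t in Ioi 0, Real.rpowIntegrand₀₁ β t 1
  have hI : 0 < I := Real.integral_rpowIntegrand₀₁_one_pos hβ
  have hα : 0 < 1 + β := by linarith [hβ.1]
  have hβ' : 0 < 1 - β := by linarith [hβ.2]
  have hB := beta_pos hα hβ'
  refine ⟨I⁻¹ * beta (1 + β) (1 - β), by positivity, fun x hx => ?_⟩
  rw [integral_betaMeasure hα hβ', ← mul_assoc, mul_inv_cancel_right₀ hB.ne',
    integral_Ioo_eq_integral_Ioi]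
  simp only [add_sub_cancel_left, sub_sub_cancel_left]
  calc x ^ β - 1 = I⁻¹ * (∫ s in Ioi 0, Real.rpowIntegrand₀₁ β s x) - I⁻¹ * I := by
        rw [← Real.rpow_eq_const_mul_integral hβ hx.le, inv_mul_cancel₀ hI.ne']
    _ = I⁻¹ * ∫ s in Ioi (0 : ℝ),
          (Real.rpowIntegrand₀₁ β s x - Real.rpowIntegrand₀₁ β s 1) := by
        rw [← mul_sub, integral_sub (Real.integrableOn_rpowIntegrand₀₁_Ioi hβ hx.le)
          (Real.integrableOn_rpowIntegrand₀₁_Ioi hβ zero_le_one)]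
    _ = _ := congrArg _ (setIntegral_congr_fun measurableSet_Ioi fun s hs =>
        rpowIntegrand₀₁_sub_one hs hx)

theorem div_one_sub_mul_add_eq_inv_sub {x : ℝ} (hx : x ≠ 1) (t : ℝ) :
    (x - 1) / ((1 - t) * x + t) = (x / (x - 1) - t)⁻¹ := by
  have : x - 1 ≠ 0 := sub_ne_zero.2 hx
  rw [← inv_div]
  congr 1
  field_simp
  ring

theorem div_sub_one_notMem_Icc {x : ℝ} (hx : 0 < x) (hx1 : x ≠ 1) :
    x / (x - 1) ∉ Icc (0 : ℝ) 1 := by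
  rintro ⟨h0, h1⟩
  rcases hx1.lt_or_gt with h | h
  · exact h0.not_gt (div_neg_of_pos_of_neg hx (by linarith))
  · linarith [(div_le_one (by linarith)).1 h1]

theorem exists_rpow_le {β : ℝ} (hβ : β ∈ Ioo (0 : ℝ) 1) (n : ℕ) :
    ∃ s v : Fin (n + 1) → ℝ, (∀ i, s i ∈ Ioc (0 : ℝ) 1) ∧ (∀ i, 0 < v i) ∧
      ∀ x > 0, x ^ β ≤ 1 + ∑ i, v i * ((x - 1) / ((1 - s i) * x + s i)) := by
  obtain ⟨K, hK, hrep⟩ := exists_rpow_sub_one_eq_integral_betaMeasure hβ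
  have := isProbabilityMeasureBeta (α := 1 + β) (β := 1 - β) (by linarith [hβ.1])
    (by linarith [hβ.2])
  have : NullSingletonClass (betaMeasure (1 + β) (1 - β)) :=
    inferInstanceAs (NullSingletonClass (volume.withDensity _))
  obtain ⟨S, w, hcard, hS, hw, hle⟩ :=
    exists_integral_inv_sub_le_sum (ae_betaMeasure_mem_Ioo (1 + β) (1 - β)) n
  have hcard' : (insert 1 S).card = n + 1 := by
    rw [Finset.card_insert_of_notMem fun h => lt_irrefl _ (hS h).2, hcard]
  let e : Fin (n + 1) ≃ {r // r ∈ insert 1 S} := (Finset.equivFinOfCardEq hcard').symm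
  refine ⟨fun i => e i, fun i => K * w (e i), fun i => ?_,
    fun i => mul_pos hK (hw _ (e i).2), fun x hx => ?_⟩
  · rcases Finset.mem_insert.1 (e i).2 with h | h
    · simp [h]
    · exact Ioo_subset_Ioc_self (hS h)
  rcases eq_or_ne x 1 with rfl | hx1
  · simp
  calc x ^ β = 1 + K * ∫ t, (x / (x - 1) - t)⁻¹ ∂betaMeasure (1 + β) (1 - β) := by
        simp only [← div_one_sub_mul_add_eq_inv_sub hx1, ← hrep x hx, add_sub_cancel]
    _ ≤ 1 + K * ∑ r ∈ insert 1 S, w r * (x / (x - 1) - r)⁻¹ := by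
        gcongr
        exact hle _ (div_sub_one_notMem_Icc hx hx1)
    _ = _ := by
        rw [← Finset.sum_coe_sort, ← e.sum_comp, Finset.mul_sum]
        simp only [div_one_sub_mul_add_eq_inv_sub hx1, mul_assoc]

end Rpow

end GaussRadau

namespace RenyiDI

section MatrixPower

variable {n o : Type*} [Fintype n] [DecidableEq n] [Fintype o] [DecidableEq o]

theorem finite_spectrum {A : Matrix n n ℂ} (hA : A.IsHermitian) : (spectrum ℝ A).Finite := by
  rw [hA.spectrum_real_eq_range_eigenvalues]
  exact Set.finite_range _

theorem nonneg_of_mem_spectrum {A : Matrix n n ℂ} (hA : A.PosSemidef) {r : ℝ}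
    (hr : r ∈ spectrum ℝ A) : 0 ≤ r := by
  rw [hA.1.spectrum_real_eq_range_eigenvalues] at hr
  obtain ⟨i, rfl⟩ := hr
  exact hA.eigenvalues_nonneg i

theorem cfc_reindex {A : Matrix n n ℂ} (hA : A.IsHermitian) (e : n ≃ o) (f : ℝ → ℝ) :
    cfc f (Matrix.reindex e e A) = Matrix.reindex e e (cfc f A) :=
  let φ : Matrix n n ℂ →⋆ₐ[ℝ] Matrix o o ℂ :=
    { (Matrix.reindexAlgEquiv ℝ ℂ e).toAlgHom with map_star' := fun _ => rfl }
  (φ.map_cfc f A ((finite_spectrum hA).continuousOn f) (continuous_id.matrix_submatrix _ _) hA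
    (hA.submatrix _)).symm

theorem cfc_eq_aeval_interpolate {A : Matrix n n ℂ} (hA : A.IsHermitian) {T : Finset ℝ}
    (hT : spectrum ℝ A ⊆ T) (f : ℝ → ℝ) :
    cfc f A = Polynomial.aeval A (Lagrange.interpolate T id f) := by
  rw [← cfc_polynomial _ A hA]
  exact cfc_congr fun r hr => (Lagrange.eval_interpolate_at_node (v := id) f
    Function.injective_id.injOn (hT hr)).symm

theorem aeval_blockDiagonal (M : o → Matrix n n ℂ) (p : Polynomial ℝ) :
    Polynomial.aeval (Matrix.blockDiagonal M) p =
      Matrix.blockDiagonal fun i => Polynomial.aeval (M i) p := by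
  let φ : (o → Matrix n n ℂ) →ₐ[ℝ] Matrix (n × o) (n × o) ℂ :=
    AlgHom.mk' (Matrix.blockDiagonalRingHom n o ℂ) Matrix.blockDiagonal_smul
  refine (Polynomial.aeval_algHom_apply φ M p).trans ?_
  refine congrArg Matrix.blockDiagonal (funext fun i => ?_)
  exact (Polynomial.aeval_algHom_apply (Pi.evalAlgHom ℝ (fun _ => Matrix n n ℂ) i) M p).symm

theorem cfc_blockDiagonal {M : o → Matrix n n ℂ} (hM : ∀ i, (M i).IsHermitian) (f : ℝ → ℝ) :
    cfc f (Matrix.blockDiagonal M) = Matrix.blockDiagonal fun i => cfc f (M i) := by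
  have hB : (Matrix.blockDiagonal M).IsHermitian := Matrix.isHermitian_blockDiagonal_iff.2 hM
  have hT : (spectrum ℝ (Matrix.blockDiagonal M) ∪ ⋃ i, spectrum ℝ (M i)).Finite :=
    (finite_spectrum hB).union (Set.finite_iUnion fun i => finite_spectrum (hM i))
  have hblock (i : o) := cfc_eq_aeval_interpolate (T := hT.toFinset) (hM i) (by
    simpa using (Set.subset_iUnion (fun i => spectrum ℝ (M i)) i).trans Set.subset_union_right) f
  rw [cfc_eq_aeval_interpolate (T := hT.toFinset) hB (by simp) f, aeval_blockDiagonal,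
    funext hblock]

theorem mpow_smul {A : Matrix n n ℂ} (hA : A.PosSemidef) {c : ℝ} (hc : 0 ≤ c) (s : ℝ) :
    mpow (c • A) s = c ^ s • mpow A s := by
  have hfin := finite_spectrum hA.1
  calc mpow (c • A) s = cfc (fun r : ℝ => (c • r) ^ s) A :=
        (cfc_comp_smul c (fun r : ℝ => r ^ s) A ((hfin.image _).continuousOn _) hA.1).symm
    _ = cfc (fun r : ℝ => c ^ s • r ^ s) A :=
        cfc_congr fun _ hr => Real.mul_rpow hc (nonneg_of_mem_spectrum hA hr)
    _ = c ^ s • mpow A s := cfc_smul _ _ A (hfin.continuousOn _)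

theorem mpow_zero {s : ℝ} (hs : s ≠ 0) : mpow (0 : Matrix n n ℂ) s = 0 := by
  simpa [Real.zero_rpow hs] using mpow_smul (n := n) Matrix.PosSemidef.zero le_rfl s

end MatrixPower

section DoubleOperatorSum

variable {n : Type*} [Fintype n] [DecidableEq n] {ρ τ : Matrix n n ℂ}

/-- The squared overlap `|⟨v_j, u_i⟩|²` of the eigenbases `u` of `ρ` and `v` of `τ`: the weights of
the Nussbaum–Szkoła distributions, through which traces of mixed products become double sums over
eigenvalues. -/
def overlap (hρ : ρ.IsHermitian) (hτ : τ.IsHermitian) (i j : n) : ℝ :=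
  Complex.normSq (((hτ.eigenvectorUnitary : Matrix n n ℂ)ᴴ * hρ.eigenvectorUnitary) j i)

/-- The double operator sum `∑ z i j |v_j⟩⟨v_j|u_i⟩⟨u_i|` over the eigenbases `u` of `ρ` and `v` of
`τ`. -/
def doubleSum (hρ : ρ.IsHermitian) (hτ : τ.IsHermitian) (z : n → n → ℝ) : Matrix n n ℂ :=
  hτ.eigenvectorUnitary * Matrix.of (fun j i => (z i j : ℂ) *
    ((hτ.eigenvectorUnitary : Matrix n n ℂ)ᴴ * hρ.eigenvectorUnitary) j i) *
      (hρ.eigenvectorUnitary : Matrix n n ℂ)ᴴ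

variable (hρ : ρ.IsHermitian) (hτ : τ.IsHermitian)

theorem overlap_nonneg (i j : n) : 0 ≤ overlap hρ hτ i j :=
  Complex.normSq_nonneg _

theorem conjTranspose_mul_self_eigenvectorUnitary :
    (hρ.eigenvectorUnitary : Matrix n n ℂ)ᴴ * hρ.eigenvectorUnitary = 1 :=
  Unitary.star_mul_self_of_mem hρ.eigenvectorUnitary.2

theorem eigenvectorUnitary_mul_conjTranspose_self :
    (hρ.eigenvectorUnitary : Matrix n n ℂ) * (hρ.eigenvectorUnitary : Matrix n n ℂ)ᴴ = 1 :=
  Unitary.mul_star_self_of_mem hρ.eigenvectorUnitary.2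

theorem cfc_eq_mul_diagonal_mul_conjTranspose (f : ℝ → ℝ) :
    cfc f ρ = hρ.eigenvectorUnitary * Matrix.diagonal (fun i => (f (hρ.eigenvalues i) : ℂ)) *
      (hρ.eigenvectorUnitary : Matrix n n ℂ)ᴴ := by
  rw [hρ.cfc_eq]
  rfl

theorem doubleSum_one : doubleSum hρ hτ (fun _ _ => 1) = 1 := by
  simp only [doubleSum, Complex.ofReal_one, one_mul]
  change (hτ.eigenvectorUnitary : Matrix n n ℂ) * ((hτ.eigenvectorUnitary : Matrix n n ℂ)ᴴ *
    hρ.eigenvectorUnitary) * (hρ.eigenvectorUnitary : Matrix n n ℂ)ᴴ = 1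
  rw [← mul_assoc, eigenvectorUnitary_mul_conjTranspose_self, one_mul,
    eigenvectorUnitary_mul_conjTranspose_self]

theorem doubleSum_mul_cfc (z : n → n → ℝ) (f : ℝ → ℝ) :
    doubleSum hρ hτ z * cfc f ρ = doubleSum hρ hτ fun i j => z i j * f (hρ.eigenvalues i) := by
  rw [cfc_eq_mul_diagonal_mul_conjTranspose hρ, doubleSum, doubleSum]
  simp only [mul_assoc]
  rw [← mul_assoc (Matrix.conjTranspose _) (hρ.eigenvectorUnitary : Matrix n n ℂ),
    conjTranspose_mul_self_eigenvectorUnitary, one_mul, ← mul_assoc (Matrix.of _)]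
  congr 2
  ext j i
  rw [Matrix.mul_diagonal, Matrix.of_apply, Matrix.of_apply]
  push_cast
  ring

theorem cfc_mul_doubleSum (z : n → n → ℝ) (g : ℝ → ℝ) :
    cfc g τ * doubleSum hρ hτ z = doubleSum hρ hτ fun i j => g (hτ.eigenvalues j) * z i j := by
  rw [cfc_eq_mul_diagonal_mul_conjTranspose hτ, doubleSum, doubleSum]
  simp only [mul_assoc]
  rw [← mul_assoc (Matrix.conjTranspose _) (hτ.eigenvectorUnitary : Matrix n n ℂ),
    conjTranspose_mul_self_eigenvectorUnitary, one_mul, ← mul_assoc (Matrix.diagonal _)]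
  congr 2
  ext j i
  rw [Matrix.diagonal_mul, Matrix.of_apply, Matrix.of_apply]
  push_cast
  ring

theorem trace_conjTranspose_doubleSum_mul_doubleSum (z w : n → n → ℝ) :
    ((doubleSum hρ hτ z)ᴴ * doubleSum hρ hτ w).trace =
      ((∑ i, ∑ j, z i j * w i j * overlap hρ hτ i j : ℝ) : ℂ) := by
  have hcancel (Y W : Matrix n n ℂ) {U V : Matrix n n ℂ} (hU : Uᴴ * U = 1) (hV : Vᴴ * V = 1) :
      ((V * Y * Uᴴ)ᴴ * (V * W * Uᴴ)).trace = (Yᴴ * W).trace := by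
    calc ((V * Y * Uᴴ)ᴴ * (V * W * Uᴴ)).trace = (U * (Yᴴ * (Vᴴ * V) * W) * Uᴴ).trace := by
          simp only [Matrix.conjTranspose_mul, Matrix.conjTranspose_conjTranspose, mul_assoc]
      _ = (Yᴴ * W).trace := by
          rw [hV, mul_one, Matrix.trace_mul_cycle, hU, one_mul]
  rw [doubleSum, doubleSum,
    hcancel _ _ (conjTranspose_mul_self_eigenvectorUnitary hρ)
      (conjTranspose_mul_self_eigenvectorUnitary hτ), Matrix.trace, Complex.ofReal_sum]
  refine Finset.sum_congr rfl fun i _ => ?_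
  rw [Matrix.diag_apply, Matrix.mul_apply, Complex.ofReal_sum]
  refine Finset.sum_congr rfl fun j _ => ?_
  rw [Matrix.conjTranspose_apply, Matrix.of_apply, Matrix.of_apply, overlap, Complex.ofReal_mul,
    ← Complex.mul_conj, star_mul', Complex.star_def, Complex.conj_ofReal]
  push_cast
  ring

theorem trace_conjTranspose_doubleSum_mul_cfc_mul (z w : n → n → ℝ) (f g : ℝ → ℝ) :
    ((doubleSum hρ hτ z)ᴴ * (cfc g τ * doubleSum hρ hτ w * cfc f ρ)).trace =
      ((∑ i, ∑ j, z i j * w i j * f (hρ.eigenvalues i) * g (hτ.eigenvalues j) *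
        overlap hρ hτ i j : ℝ) : ℂ) := by
  rw [cfc_mul_doubleSum, doubleSum_mul_cfc, trace_conjTranspose_doubleSum_mul_doubleSum]
  refine congrArg _ (Finset.sum_congr rfl fun i _ => Finset.sum_congr rfl fun j _ => ?_)
  ring

theorem trace_cfc_mul_cfc (f g : ℝ → ℝ) :
    (cfc f ρ * cfc g τ).trace = ((∑ i, ∑ j, f (hρ.eigenvalues i) * g (hτ.eigenvalues j) *
      overlap hρ hτ i j : ℝ) : ℂ) := by
  have h := trace_conjTranspose_doubleSum_mul_cfc_mul hρ hτ (fun _ _ => 1) (fun _ _ => 1) f g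
  simpa only [doubleSum_one, Matrix.conjTranspose_one, one_mul, mul_one,
    Matrix.trace_mul_comm (cfc g τ)] using h

end DoubleOperatorSum

section NodeTerm

variable {e : Type*} [Fintype e] {ρ τ : Matrix e e ℂ}

theorem re_trace_mul_mul_conjTranspose_nonneg (hρ : ρ.PosSemidef) (Z : Matrix e e ℂ) :
    0 ≤ (ρ * (Z * Zᴴ)).trace.re := by
  have h := (hρ.conjTranspose_mul_mul_same Z).trace_nonneg
  rw [Matrix.trace_mul_cycle, Matrix.trace_mul_comm] at h
  exact (Complex.nonneg_iff.1 h).1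

theorem re_trace_mul_polyQ (τ : Matrix e e ℂ) (α : ℝ) {m : ℕ} (w : Fin m → ℝ)
    (Z : Fin m → Matrix e e ℂ) :
    (τ * polyQ α w Z).trace.re = Real.sin (α * Real.pi) / Real.pi *
      ∑ i, w i * (τ * (Z i * (Z i)ᴴ)).trace.re := by
  rw [polyQ, mul_smul_comm, Matrix.trace_smul, Complex.smul_re, Finset.mul_sum, Matrix.trace_sum,
    Complex.re_sum, smul_eq_mul]
  simp only [mul_smul_comm _ τ, Matrix.trace_smul, Complex.smul_re, smul_eq_mul]

variable [DecidableEq e]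

theorem re_trace_mul_polyP (ρ : Matrix e e ℂ) (α : ℝ) {m : ℕ} (s w : Fin m → ℝ)
    (Z : Fin m → Matrix e e ℂ) :
    (ρ * polyP α s w Z).trace.re = ρ.trace.re + Real.sin (α * Real.pi) / Real.pi *
      ∑ i, w i / s i * (ρ * (1 + Z i + (Z i)ᴴ + (1 - s i) • ((Z i)ᴴ * Z i))).trace.re := by
  rw [polyP, mul_add, mul_one, Matrix.trace_add, Complex.add_re, mul_smul_comm,
    Matrix.trace_smul, Complex.smul_re, Finset.mul_sum, Matrix.trace_sum, Complex.re_sum]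
  simp only [mul_smul_comm _ ρ, Matrix.trace_smul, Complex.smul_re, smul_eq_mul]

/-- The contribution `Tr[ρ (1 + Z + Z† + (1 - t) Z† Z)] + t Tr[τ Z Z†]` of a node `t` to the
objective, up to the factor `(sin(απ)/π) w / t`. -/
def nodeTerm (ρ τ : Matrix e e ℂ) (t : ℝ) (Z : Matrix e e ℂ) : ℝ :=
  (ρ * (1 + Z + Zᴴ + (1 - t) • (Zᴴ * Z))).trace.re + t * (τ * (Z * Zᴴ)).trace.re

theorem re_trace_polyP_add_polyQ (ρ τ : Matrix e e ℂ) (α : ℝ) {m : ℕ} {s : Fin m → ℝ}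
    (hs : ∀ i, s i ≠ 0) (w : Fin m → ℝ) (Z : Fin m → Matrix e e ℂ) :
    (ρ * polyP α s w Z).trace.re + (τ * polyQ α w Z).trace.re =
      ρ.trace.re + Real.sin (α * Real.pi) / Real.pi *
        ∑ i, w i / s i * nodeTerm ρ τ (s i) (Z i) := by
  rw [re_trace_mul_polyP, re_trace_mul_polyQ, add_assoc, ← mul_add, ← Finset.sum_add_distrib]
  congr! 3 with i
  rw [nodeTerm, mul_add (w i / s i), ← mul_assoc (w i / s i), div_mul_cancel₀ _ (hs i)]

theorem nodeTerm_nonneg (hρ : ρ.PosSemidef) (hle : (τ - ρ).PosSemidef) {t : ℝ}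
    (ht : t ∈ Set.Icc (0 : ℝ) 1) (Z : Matrix e e ℂ) : 0 ≤ nodeTerm ρ τ t Z := by
  have hsum : nodeTerm ρ τ t Z = (1 - t) * (ρ * ((1 + Z)ᴴ * (1 + Z)ᴴᴴ)).trace.re +
      t * ((ρ * ((1 + Z) * (1 + Z)ᴴ)).trace.re + ((τ - ρ) * (Z * Zᴴ)).trace.re) := by
    simp only [nodeTerm, Matrix.conjTranspose_add, Matrix.conjTranspose_one,
      Matrix.conjTranspose_conjTranspose, mul_add, add_mul, mul_one, one_mul, sub_mul,
      Matrix.trace_add, Matrix.trace_sub, Complex.add_re, Complex.sub_re, mul_smul_comm,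
      Matrix.trace_smul, Complex.smul_re, smul_eq_mul]
    ring
  rw [hsum]
  exact add_nonneg (mul_nonneg (sub_nonneg.2 ht.2) (re_trace_mul_mul_conjTranspose_nonneg hρ _))
    (mul_nonneg ht.1 (add_nonneg (re_trace_mul_mul_conjTranspose_nonneg hρ _)
      (re_trace_mul_mul_conjTranspose_nonneg hle Z)))

theorem re_trace_eq_sum_overlap (hρ : ρ.IsHermitian) (hτ : τ.IsHermitian) :
    ρ.trace.re = ∑ i, ∑ j, hρ.eigenvalues i * overlap hρ hτ i j := by
  have h := trace_cfc_mul_cfc hρ hτ (fun r => r) fun _ => 1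
  rw [cfc_id' ℝ ρ hρ.isSelfAdjoint, cfc_const_one ℝ τ hτ.isSelfAdjoint, mul_one] at h
  simp only [h, mul_one, Complex.ofReal_re]

theorem nodeTerm_doubleSum (hρ : ρ.IsHermitian) (hτ : τ.IsHermitian) (t : ℝ) (z : e → e → ℝ) :
    nodeTerm ρ τ t (doubleSum hρ hτ z) = ∑ i, ∑ j, (hρ.eigenvalues i +
      2 * hρ.eigenvalues i * z i j + ((1 - t) * hρ.eigenvalues i + t * hτ.eigenvalues j) *
        z i j ^ 2) * overlap hρ hτ i j := by
  have hquad (z w : e → e → ℝ) (f g : ℝ → ℝ) := congrArg Complex.re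
    (trace_conjTranspose_doubleSum_mul_cfc_mul hρ hτ z w f g)
  simp only [Complex.ofReal_re] at hquad
  have hright := hquad (fun _ _ => 1) z (fun r => r) fun _ => 1
  have hleft := hquad z (fun _ _ => 1) (fun r => r) fun _ => 1
  have hρZ := hquad z z (fun r => r) fun _ => 1
  have hτZ := hquad z z (fun _ => 1) fun r => r
  simp only [cfc_id' ℝ ρ hρ.isSelfAdjoint, cfc_id' ℝ τ hτ.isSelfAdjoint,
    cfc_const_one ℝ ρ hρ.isSelfAdjoint, cfc_const_one ℝ τ hτ.isSelfAdjoint, doubleSum_one,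
    Matrix.conjTranspose_one, one_mul, mul_one] at hright hleft hρZ hτZ
  simp only [nodeTerm, mul_add, mul_one, mul_smul_comm, Matrix.trace_add, Matrix.trace_smul,
    Complex.add_re, Complex.smul_re, smul_eq_mul]
  rw [re_trace_eq_sum_overlap hρ hτ, Matrix.trace_mul_comm ρ (doubleSum hρ hτ z), hright,
    Matrix.trace_mul_comm ρ (doubleSum hρ hτ z)ᴴ, hleft, Matrix.trace_mul_comm ρ, mul_assoc, hρZ,
    ← mul_assoc τ, Matrix.trace_mul_comm (τ * _), hτZ]
  simp only [Finset.mul_sum, ← Finset.sum_add_distrib]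
  exact Finset.sum_congr rfl fun i _ => Finset.sum_congr rfl fun j _ => by ring

theorem re_trace_mul_cfc_indicator_zero_nonpos (hτ : τ.IsHermitian)
    (hle : (τ - ρ).PosSemidef) : (ρ * cfc (Set.indicator {0} 1 : ℝ → ℝ) τ).trace.re ≤ 0 := by
  have hcont (f : ℝ → ℝ) : ContinuousOn f (spectrum ℝ τ) := (finite_spectrum hτ).continuousOn f
  set g : ℝ → ℝ := Set.indicator {0} 1
  have hproj : cfc g τ * (cfc g τ)ᴴ = cfc g τ := by
    rw [← Matrix.star_eq_conjTranspose, ← cfc_star, ← cfc_mul _ _ _ (hcont _) (hcont _)]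
    exact cfc_congr fun r _ => by by_cases hr : r = 0 <;> simp [g, hr]
  have hker : τ * cfc g τ = 0 := by
    nth_rw 1 [← cfc_id' ℝ τ hτ.isSelfAdjoint]
    rw [← cfc_mul _ _ _ (hcont _) (hcont _), ← cfc_zero ℝ τ]
    exact cfc_congr fun r _ => by by_cases hr : r = 0 <;> simp [g, hr]
  have h := re_trace_mul_mul_conjTranspose_nonneg hle (cfc g τ)
  rwa [hproj, sub_mul, hker, zero_sub, Matrix.trace_neg, Complex.neg_re, neg_nonneg] at h

theorem eigenvalue_mul_overlap_eq_zero (hρ : ρ.PosSemidef) (hτ : τ.IsHermitian)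
    (hle : (τ - ρ).PosSemidef) (i : e) {j : e} (hj : hτ.eigenvalues j = 0) :
    hρ.1.eigenvalues i * overlap hρ.1 hτ i j = 0 := by
  have htr := re_trace_mul_cfc_indicator_zero_nonpos hτ hle
  set g : ℝ → ℝ := Set.indicator {0} 1
  have h := trace_cfc_mul_cfc hρ.1 hτ (fun r => r) g
  rw [cfc_id' ℝ ρ hρ.1.isSelfAdjoint] at h
  rw [h, Complex.ofReal_re, ← Fintype.sum_prod_type'] at htr
  have hnn (p : e × e) :
      0 ≤ hρ.1.eigenvalues p.1 * g (hτ.eigenvalues p.2) * overlap hρ.1 hτ p.1 p.2 :=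
    mul_nonneg (mul_nonneg (hρ.eigenvalues_nonneg _) (Set.indicator_nonneg (by simp) _))
      (overlap_nonneg _ _ _ _)
  have hij := (Finset.sum_eq_zero_iff_of_nonneg fun p _ => hnn p).1
    (htr.antisymm (Finset.sum_nonneg fun p _ => hnn p)) (i, j) (Finset.mem_univ _)
  simpa [g, hj] using hij

theorem rpow_mul_rpow_eq {α l u : ℝ} (hα : α ≠ 0) (hl : 0 ≤ l) (hu : 0 < u) :
    l ^ α * u ^ (1 - α) = l * (l / u) ^ (α - 1) := by
  rw [Real.div_rpow hl hu.le, ← mul_div_assoc, ← Real.rpow_one_add' hl (by simpa),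
    div_eq_mul_inv, ← Real.rpow_neg hu.le, add_sub_cancel, neg_sub]

theorem quadratic_neg_div {l u t : ℝ} (hu : u ≠ 0) (hD : (1 - t) * l + t * u ≠ 0) :
    l + 2 * l * (-l / ((1 - t) * l + t * u)) +
      ((1 - t) * l + t * u) * (-l / ((1 - t) * l + t * u)) ^ 2 =
      -(t * (l * ((l / u - 1) / ((1 - t) * (l / u) + t)))) := by
  have hx : (1 - t) * (l / u) + t = ((1 - t) * l + t * u) / u := by field_simp
  have hsub : (1 - t) * l + t * u - l = t * (u - l) := by ring
  rw [hx]
  generalize (1 - t) * l + t * u = D at hD hsub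
  calc l + 2 * l * (-l / D) + D * (-l / D) ^ 2 = l * (D - l) / D := by
        field_simp
        ring
    _ = -(t * (l * ((l / u - 1) / (D / u)))) := by
        rw [hsub]
        field_simp
        ring

theorem rpow_mul_rpow_le {α : ℝ} (hα : α ≠ 0) {m : ℕ} {s v : Fin m → ℝ}
    (hs : ∀ i, s i ∈ Set.Ioc (0 : ℝ) 1)
    (hv : ∀ x > 0, x ^ (α - 1) ≤ 1 + ∑ i, v i * ((x - 1) / ((1 - s i) * x + s i)))
    {l u : ℝ} (hl : 0 ≤ l) (hu : 0 < u) :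
    l ^ α * u ^ (1 - α) ≤ l - ∑ k, v k / s k * (l + 2 * l * (-l / ((1 - s k) * l + s k * u)) +
      ((1 - s k) * l + s k * u) * (-l / ((1 - s k) * l + s k * u)) ^ 2) := by
  rcases hl.eq_or_lt with rfl | hl
  · simp [Real.zero_rpow hα]
  have hD (k : Fin m) : 0 < (1 - s k) * l + s k * u :=
    add_pos_of_nonneg_of_pos (mul_nonneg (sub_nonneg.2 (hs k).2) hl.le) (mul_pos (hs k).1 hu)
  calc l ^ α * u ^ (1 - α) = l * (l / u) ^ (α - 1) := rpow_mul_rpow_eq hα hl.le hu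
    _ ≤ l * (1 + ∑ k, v k * ((l / u - 1) / ((1 - s k) * (l / u) + s k))) :=
        mul_le_mul_of_nonneg_left (hv _ (div_pos hl hu)) hl.le
    _ = l - ∑ k, v k / s k * -(s k * (l * ((l / u - 1) / ((1 - s k) * (l / u) + s k)))) := by
        rw [mul_add, mul_one, Finset.mul_sum, ← sub_neg_eq_add, ← Finset.sum_neg_distrib]
        congr! 2 with k
        have := (hs k).1.ne'
        field_simp
    _ = _ := by
        congr! 3 with k
        rw [quadratic_neg_div hu.ne' (hD k).ne']

theorem exists_trace_mpow_mul_mpow_le (hρ : ρ.PosSemidef) (hτ : τ.PosSemidef)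
    (hle : (τ - ρ).PosSemidef) {α : ℝ} (hα : α ≠ 0) {m : ℕ} {s v : Fin m → ℝ}
    (hs : ∀ i, s i ∈ Set.Ioc (0 : ℝ) 1)
    (hv : ∀ x > 0, x ^ (α - 1) ≤ 1 + ∑ i, v i * ((x - 1) / ((1 - s i) * x + s i))) :
    ∃ Z : Fin m → Matrix e e ℂ, (mpow ρ α * mpow τ (1 - α)).trace.re ≤
      ρ.trace.re - ∑ k, v k / s k * nodeTerm ρ τ (s k) (Z k) := by
  set lam := hρ.1.eigenvalues
  set mu := hτ.1.eigenvalues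
  set g := overlap hρ.1 hτ.1
  refine ⟨fun k => doubleSum hρ.1 hτ.1 fun i j =>
    -lam i / ((1 - s k) * lam i + s k * mu j), ?_⟩
  have hterm (i j : e) : lam i ^ α * mu j ^ (1 - α) * g i j ≤
      lam i * g i j - ∑ k, v k / s k * ((lam i +
        2 * lam i * (-lam i / ((1 - s k) * lam i + s k * mu j)) +
          ((1 - s k) * lam i + s k * mu j) *
            (-lam i / ((1 - s k) * lam i + s k * mu j)) ^ 2) * g i j) := by
    rcases (hτ.eigenvalues_nonneg j).eq_or_lt with hj | hj
    · rcases mul_eq_zero.1 (eigenvalue_mul_overlap_eq_zero hρ hτ.1 hle i hj.symm) with h | h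
      · simp [lam, h, Real.zero_rpow hα]
      · simp [g, h]
    · simp only [← mul_assoc, ← Finset.sum_mul, ← sub_mul]
      exact mul_le_mul_of_nonneg_right
        (rpow_mul_rpow_le hα hs hv (hρ.eigenvalues_nonneg i) hj) (overlap_nonneg _ _ i j)
  calc (mpow ρ α * mpow τ (1 - α)).trace.re = ∑ i, ∑ j, lam i ^ α * mu j ^ (1 - α) * g i j :=
        congrArg Complex.re (trace_cfc_mul_cfc hρ.1 hτ.1 _ _)
    _ ≤ ∑ i, ∑ j, (lam i * g i j - ∑ k, v k / s k * _) :=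
        Finset.sum_le_sum fun i _ => Finset.sum_le_sum fun j _ => hterm i j
    _ = _ := by
        simp only [nodeTerm_doubleSum, re_trace_eq_sum_overlap hρ.1 hτ.1, Finset.mul_sum,
          Finset.sum_sub_distrib]
        congr 1
        simp only [Finset.sum_comm (t := (Finset.univ : Finset (Fin m)))]
        rfl

theorem sin_mul_pi_div_pi_neg {α : ℝ} (hα : α ∈ Set.Ioo (1 : ℝ) 2) :
    Real.sin (α * Real.pi) / Real.pi < 0 := by
  have hpi := Real.pi_pos
  have h : 0 < Real.sin ((α - 1) * Real.pi) :=
    Real.sin_pos_of_pos_of_lt_pi (by nlinarith [hα.1]) (by nlinarith [hα.2])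
  rw [sub_one_mul, Real.sin_sub_pi, neg_pos] at h
  exact div_neg_of_neg_of_pos h hpi

theorem trace_mpow_mul_mpow_le_trace (hρ : ρ.PosSemidef) (hτ : τ.PosSemidef)
    (hle : (τ - ρ).PosSemidef) {α : ℝ} (hα : α ∈ Set.Ioo (1 : ℝ) 2) :
    (mpow ρ α * mpow τ (1 - α)).trace.re ≤ ρ.trace.re := by
  obtain ⟨s, v, hs, hv, hrule⟩ :=
    GaussRadau.exists_rpow_le (β := α - 1) ⟨by linarith [hα.1], by linarith [hα.2]⟩ 0
  obtain ⟨Z, hZ⟩ := exists_trace_mpow_mul_mpow_le hρ hτ hle (by linarith [hα.1]) hs hrule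
  exact hZ.trans (sub_le_self _ (Finset.sum_nonneg fun i _ => mul_nonneg
    (div_nonneg (hv i).le (hs i).1.le) (nodeTerm_nonneg hρ hle (Set.Ioc_subset_Icc_self (hs i)) _)))

end NodeTerm

theorem exists_nodes_trace_mpow_mul_mpow_le {α : ℝ} (hα : α ∈ Set.Ioo (1 : ℝ) 2) (m : ℕ) :
    ∃ s w : Fin m → ℝ, (∀ i, s i ∈ Set.Ioc (0 : ℝ) 1) ∧ (∀ i, 0 < w i) ∧
      ∀ {e : Type*} [Fintype e] [DecidableEq e] {ρ τ : Matrix e e ℂ}, ρ.PosSemidef →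
        τ.PosSemidef → (τ - ρ).PosSemidef → ∃ Z : Fin m → Matrix e e ℂ,
          (mpow ρ α * mpow τ (1 - α)).trace.re ≤
            (ρ * polyP α s w Z).trace.re + (τ * polyQ α w Z).trace.re := by
  have hκ := sin_mul_pi_div_pi_neg hα
  cases m with
  | zero =>
    refine ⟨Fin.elim0, Fin.elim0, fun i => i.elim0, fun i => i.elim0,
      fun hρ hτ hle => ⟨Fin.elim0, ?_⟩⟩
    rw [re_trace_polyP_add_polyQ _ _ _ fun i => i.elim0, Fin.sum_univ_zero, mul_zero, add_zero]
    exact trace_mpow_mul_mpow_le_trace hρ hτ hle hα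
  | succ n =>
    obtain ⟨s, v, hs, hv, hrule⟩ :=
      GaussRadau.exists_rpow_le (β := α - 1) ⟨by linarith [hα.1], by linarith [hα.2]⟩ n
    refine ⟨s, fun i => v i / -(Real.sin (α * Real.pi) / Real.pi), hs,
      fun i => div_pos (hv i) (neg_pos.2 hκ), fun {e} _ _ {ρ τ} hρ hτ hle => ?_⟩
    obtain ⟨Z, hZ⟩ := exists_trace_mpow_mul_mpow_le hρ hτ hle (by linarith [hα.1]) hs hrule
    refine ⟨Z, hZ.trans_eq ?_⟩
    rw [re_trace_polyP_add_polyQ _ _ _ fun i => (hs i).1.ne', sub_eq_add_neg, Finset.mul_sum,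
      ← Finset.sum_neg_distrib]
    congr! 2 with i
    generalize Real.sin (α * Real.pi) / Real.pi = κ at hκ
    have hκ0 := hκ.ne
    field_simp

section BlockMatrix

variable {n o q : Type*} [DecidableEq o]

theorem trace_reindex_blockDiagonal_mul [Fintype n] [Fintype o] [Fintype q] (f : n × o ≃ q)
    (M N : o → Matrix n n ℂ) :
    (Matrix.reindex f f (Matrix.blockDiagonal M) *
      Matrix.reindex f f (Matrix.blockDiagonal N)).trace = ∑ i, (M i * N i).trace := by
  rw [← Matrix.trace_blockDiagonal, Matrix.blockDiagonal_mul, Matrix.reindex_apply,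
    Matrix.reindex_apply, Matrix.submatrix_mul_equiv]
  exact Equiv.sum_comp f.symm fun i => (Matrix.blockDiagonal M * Matrix.blockDiagonal N) i i

open scoped MatrixOrder in
theorem exists_eq_conjTranspose_mul_self [Fintype n] {K : Matrix n n ℂ} (hK : K.PosSemidef) :
    ∃ G : Matrix n n ℂ, K = Gᴴ * G := by
  classical
  exact CStarAlgebra.nonneg_iff_eq_star_mul_self.1 hK.nonneg

theorem posSemidef_blockDiagonal [Finite n] [Finite o] {M : o → Matrix n n ℂ}
    (hM : ∀ i, (M i).PosSemidef) : (Matrix.blockDiagonal M).PosSemidef := by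
  cases nonempty_fintype n
  cases nonempty_fintype o
  choose G hG using fun i => exists_eq_conjTranspose_mul_self (hM i)
  rw [funext hG, Matrix.blockDiagonal_mul, ← Matrix.blockDiagonal_conjTranspose]
  exact Matrix.posSemidef_conjTranspose_mul_self _

end BlockMatrix

section PartialTrace

variable {qA qB e : Type*} [Fintype qA] [Fintype qB]

theorem ptraceAB_sum {ι : Type*} (s : Finset ι) (S : ι → Matrix (qA × qB × e) (qA × qB × e) ℂ) :
    ptraceAB (∑ u ∈ s, S u) = ∑ u ∈ s, ptraceAB (S u) :=
  let φ : Matrix (qA × qB × e) (qA × qB × e) ℂ →+ Matrix e e ℂ :=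
    { toFun := ptraceAB
      map_zero' := by ext; simp [ptraceAB]
      map_add' := fun S T => by ext; simp [ptraceAB, Finset.sum_add_distrib] }
  map_sum φ S s

theorem ptraceAB_eq_sum_submatrix (S : Matrix (qA × qB × e) (qA × qB × e) ℂ) :
    ptraceAB S = ∑ i, ∑ j, S.submatrix (fun k => (i, j, k)) (fun k => (i, j, k)) := by
  ext k k'
  simp [ptraceAB, Matrix.sum_apply]

theorem ptraceAB_posSemidef {S : Matrix (qA × qB × e) (qA × qB × e) ℂ} (hS : S.PosSemidef) :
    (ptraceAB S).PosSemidef := by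
  rw [ptraceAB_eq_sum_submatrix]
  exact Matrix.posSemidef_sum _ fun i _ => Matrix.posSemidef_sum _ fun j _ => hS.submatrix _

variable [Fintype e]

theorem trace_ptraceAB (S : Matrix (qA × qB × e) (qA × qB × e) ℂ) :
    (ptraceAB S).trace = S.trace := by
  simp only [Matrix.trace, Matrix.diag, ptraceAB, Matrix.of_apply, Fintype.sum_prod_type]
  rw [Finset.sum_comm]
  exact Finset.sum_congr rfl fun i _ => Finset.sum_comm

theorem ptraceAB_mul_one_kronecker [DecidableEq qA] [DecidableEq qB]
    (S : Matrix (qA × qB × e) (qA × qB × e) ℂ) (W : Matrix e e ℂ) :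
    ptraceAB (S * ((1 : Matrix qA qA ℂ) ⊗ₖ ((1 : Matrix qB qB ℂ) ⊗ₖ W))) = ptraceAB S * W := by
  ext k k'
  have hentry (i : qA) (j : qB) :
      (S * ((1 : Matrix qA qA ℂ) ⊗ₖ ((1 : Matrix qB qB ℂ) ⊗ₖ W))) (i, j, k) (i, j, k') =
        ∑ l, S (i, j, k) (i, j, l) * W l k' := by
    simp [Matrix.mul_apply, Fintype.sum_prod_type, Matrix.one_apply, Finset.sum_ite_irrel]
  rw [Matrix.mul_apply (M := ptraceAB S)]
  simp only [ptraceAB, Matrix.of_apply, hentry, Finset.sum_mul]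
  rw [Finset.sum_comm (s := (Finset.univ : Finset e))]
  exact Finset.sum_congr rfl fun i _ => Finset.sum_comm

variable [DecidableEq e]

theorem ptraceAB_kronecker_mul_comm (K : Matrix qA qA ℂ) (N : Matrix qB qB ℂ)
    (S : Matrix (qA × qB × e) (qA × qB × e) ℂ) :
    ptraceAB ((K ⊗ₖ (N ⊗ₖ (1 : Matrix e e ℂ))) * S) =
      ptraceAB (S * (K ⊗ₖ (N ⊗ₖ (1 : Matrix e e ℂ)))) := by
  ext k k'
  simp only [ptraceAB, Matrix.of_apply, Matrix.mul_apply, Matrix.kroneckerMap_apply,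
    Fintype.sum_prod_type, Matrix.one_apply, ite_mul, zero_mul, mul_ite, mul_one, mul_zero,
    Finset.sum_ite_eq, Finset.sum_ite_eq', Finset.mem_univ, if_true]
  calc ∑ i, ∑ j, ∑ i', ∑ j', K i i' * N j j' * S (i', j', k) (i, j, k')
      = ∑ v : qA × qB, ∑ v' : qA × qB,
          K v.1 v'.1 * N v.2 v'.2 * S (v'.1, v'.2, k) (v.1, v.2, k') := by
        simp only [Fintype.sum_prod_type]
    _ = ∑ v' : qA × qB, ∑ v : qA × qB,
          S (v'.1, v'.2, k) (v.1, v.2, k') * (K v.1 v'.1 * N v.2 v'.2) := by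
        rw [Finset.sum_comm]
        simp only [mul_comm]
    _ = ∑ i', ∑ j', ∑ i, ∑ j, S (i', j', k) (i, j, k') * (K i i' * N j j') := by
        simp only [Fintype.sum_prod_type]

theorem ptraceAB_kronecker_mul_posSemidef {K : Matrix qA qA ℂ}
    {N : Matrix qB qB ℂ} {S : Matrix (qA × qB × e) (qA × qB × e) ℂ} (hK : K.PosSemidef)
    (hN : N.PosSemidef) (hS : S.PosSemidef) :
    (ptraceAB ((K ⊗ₖ (N ⊗ₖ (1 : Matrix e e ℂ))) * S)).PosSemidef := by
  classical
  obtain ⟨G, rfl⟩ := exists_eq_conjTranspose_mul_self hK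
  obtain ⟨H, rfl⟩ := exists_eq_conjTranspose_mul_self hN
  have hfactor : (Gᴴ * G) ⊗ₖ ((Hᴴ * H) ⊗ₖ (1 : Matrix e e ℂ)) =
      (Gᴴ ⊗ₖ (Hᴴ ⊗ₖ 1)) * (G ⊗ₖ (H ⊗ₖ 1)) := by
    rw [← Matrix.mul_kronecker_mul, ← Matrix.mul_kronecker_mul, one_mul]
  have hstar : Gᴴ ⊗ₖ (Hᴴ ⊗ₖ (1 : Matrix e e ℂ)) = (G ⊗ₖ (H ⊗ₖ 1))ᴴ := by
    rw [Matrix.conjTranspose_kronecker, Matrix.conjTranspose_kronecker, Matrix.conjTranspose_one]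
  rw [hfactor, mul_assoc, ptraceAB_kronecker_mul_comm, hstar]
  exact ptraceAB_posSemidef (hS.mul_mul_conjTranspose_same _)

theorem trace_mul_kronecker (K : Matrix qA qA ℂ) (N : Matrix qB qB ℂ) (W : Matrix e e ℂ)
    (S : Matrix (qA × qB × e) (qA × qB × e) ℂ) :
    (S * (K ⊗ₖ (N ⊗ₖ W))).trace =
      (ptraceAB ((K ⊗ₖ (N ⊗ₖ (1 : Matrix e e ℂ))) * S) * W).trace := by
  classical
  rw [← ptraceAB_mul_one_kronecker, trace_ptraceAB, Matrix.trace_mul_cycle,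
    ← Matrix.mul_kronecker_mul, ← Matrix.mul_kronecker_mul, one_mul, one_mul, mul_one,
    Matrix.trace_mul_comm]

end PartialTrace

namespace SingleRound

variable {X Y A B C qA qB e : Type*} [Fintype X] [Fintype Y] [Fintype A] [Fintype B]
  [Fintype qA] [Fintype qB] [Fintype e] [DecidableEq C]
  [DecidableEq qA] [DecidableEq qB] [DecidableEq e]

/-- The block `M(σ)_{E ∧ a, c̄ | x, y, t}` of `M(σ)_{A C̄ E | x, y, t}` at `A = a`, `C̄ = c`: the
unnormalized state of `E` given these two outcomes. -/
def block (R : SingleRound X Y A B C qA qB e) (c : C) (x : X) (y : Y) (t : Fin 2) (a : A) :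
    Matrix e e ℂ :=
  ∑ b with R.f a b x y t = c, ptraceAB ((R.M x a ⊗ₖ (R.N y b ⊗ₖ (1 : Matrix e e ℂ))) * R.σ)

variable (R : SingleRound X Y A B C qA qB e) (c : C) (x : X) (y : Y) (t : Fin 2) (a : A)

theorem block_posSemidef : (R.block c x y t a).PosSemidef :=
  Matrix.posSemidef_sum _ fun b _ => ptraceAB_kronecker_mul_posSemidef
    ((R.M_povm x).posSemidef a) ((R.N_povm y).posSemidef b) R.σ_posSemidef

theorem sum_block [Fintype C] : ∑ a, ∑ c, R.block c x y t a = ptraceAB R.σ := by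
  have hsum_c (a : A) : ∑ c, R.block c x y t a =
      ∑ b, ptraceAB ((R.M x a ⊗ₖ (R.N y b ⊗ₖ (1 : Matrix e e ℂ))) * R.σ) :=
    Finset.sum_fiberwise Finset.univ (fun b => R.f a b x y t) _
  have hsum_ab : ∑ a, ∑ b, R.M x a ⊗ₖ (R.N y b ⊗ₖ (1 : Matrix e e ℂ)) =
      (∑ a, R.M x a) ⊗ₖ ((∑ b, R.N y b) ⊗ₖ (1 : Matrix e e ℂ)) := by
    ext i j
    simp only [Matrix.sum_apply, Matrix.kroneckerMap_apply, Finset.sum_mul, Finset.mul_sum]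
    exact Finset.sum_comm
  simp only [hsum_c, ← ptraceAB_sum, ← Finset.sum_mul]
  rw [hsum_ab, (R.M_povm x).sum_eq_one, (R.N_povm y).sum_eq_one, Matrix.one_kronecker_one,
    Matrix.one_kronecker_one, one_mul]

theorem ptraceAB_sub_block_posSemidef [Finite C] :
    (ptraceAB R.σ - R.block c x y t a).PosSemidef := by
  classical
  cases nonempty_fintype C
  rw [← R.sum_block x y t, ← Fintype.sum_prod_type' (f := fun a c => R.block c x y t a),
    ← Finset.add_sum_erase Finset.univ (fun u : A × C => R.block u.2 x y t u.1)
      (Finset.mem_univ (a, c)), add_sub_cancel_left]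
  exact Matrix.posSemidef_sum _ fun u _ => R.block_posSemidef _ _ _ _ _

theorem probAC_eq_re_trace_block : R.probAC a c x y t = (R.block c x y t a).trace.re := by
  simp only [probAC, born, block, Matrix.trace_sum, Complex.re_sum, trace_ptraceAB]

theorem probAC_nonneg : 0 ≤ R.probAC a c x y t := by
  rw [probAC_eq_re_trace_block]
  exact (Complex.nonneg_iff.1 (R.block_posSemidef c x y t a).trace_nonneg).1

theorem block_eq_zero_of_probAC_eq_zero (h : R.probAC a c x y t = 0) : R.block c x y t a = 0 := by
  have hpos := R.block_posSemidef c x y t a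
  rw [probAC_eq_re_trace_block] at h
  exact hpos.trace_eq_zero_iff.1 (Complex.ext h (Complex.nonneg_iff.1 hpos.trace_nonneg).2.symm)

theorem block_eq_zero_of_not_probC_pos (h : ¬ 0 < R.probC c x y t) : R.block c x y t a = 0 := by
  have hnonneg : ∀ a ∈ Finset.univ, 0 ≤ R.probAC a c x y t := fun a _ => R.probAC_nonneg c x y t a
  have hzero : R.probC c x y t = 0 := le_antisymm (not_lt.1 h) (Finset.sum_nonneg hnonneg)
  exact R.block_eq_zero_of_probAC_eq_zero c x y t a
    ((Finset.sum_eq_zero_iff_of_nonneg hnonneg).1 hzero a (Finset.mem_univ a))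

theorem block_eq_zero_of_not_probAgivenC_pos (h : ¬ 0 < R.probAgivenC a c x y t) :
    R.block c x y t a = 0 := by
  by_cases hC : 0 < R.probC c x y t
  · exact R.block_eq_zero_of_probAC_eq_zero c x y t a
      (le_antisymm (not_lt.1 fun hAC => h (div_pos hAC hC)) (R.probAC_nonneg c x y t a))
  · exact R.block_eq_zero_of_not_probC_pos c x y t a hC

theorem objective_eq_sum_block (α : ℝ) {m : ℕ} (s w : Fin m → ℝ) (Z : A → Fin m → Matrix e e ℂ) :
    R.objective α s w c x y t Z = ∑ a with 0 < R.probAgivenC a c x y t,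
      ((R.block c x y t a * polyP α s w (Z a)).trace.re +
        (ptraceAB R.σ * polyQ α w (Z a)).trace.re) := by
  refine Finset.sum_congr rfl fun a _ => ?_
  rw [mul_add, Matrix.trace_add, Complex.add_re, Finset.mul_sum, Matrix.trace_sum,
    trace_mul_kronecker 1 1, Matrix.one_kronecker_one, Matrix.one_kronecker_one, one_mul, block,
    Finset.sum_mul, Matrix.trace_sum]
  simp only [trace_mul_kronecker]

theorem bddAbove_range_objective [Finite C] {α : ℝ} (hα : α ∈ Set.Ioo (1 : ℝ) 2) {m : ℕ}
    {s w : Fin m → ℝ} (hs : ∀ i, s i ∈ Set.Ioc (0 : ℝ) 1) (hw : ∀ i, 0 < w i) :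
    BddAbove (Set.range (R.objective α s w c x y t)) := by
  refine ⟨∑ a with 0 < R.probAgivenC a c x y t, (R.block c x y t a).trace.re, ?_⟩
  rintro _ ⟨Z, rfl⟩
  rw [objective_eq_sum_block]
  refine Finset.sum_le_sum fun a _ => ?_
  rw [re_trace_polyP_add_polyQ _ _ _ fun i => (hs i).1.ne']
  refine add_le_of_nonpos_right (mul_nonpos_of_nonpos_of_nonneg
    (sin_mul_pi_div_pi_neg hα).le (Finset.sum_nonneg fun i _ => ?_))
  exact mul_nonneg (div_nonneg (hw i).le (hs i).1.le) (nodeTerm_nonneg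
    (R.block_posSemidef c x y t a) (R.ptraceAB_sub_block_posSemidef c x y t a)
    (Set.Ioc_subset_Icc_self (hs i)) _)

variable [DecidableEq A]

theorem condOut_apply (a a' : A) (c c' : C) (k k' : e) :
    R.condOut x y t (a, c, k) (a', c', k') =
      if a = a' ∧ c = c' then R.block c x y t a k k' else 0 := by
  simp only [condOut, Matrix.sum_apply, Matrix.kroneckerMap_apply, Matrix.single_apply]
  rw [Finset.sum_eq_single a (fun a₁ _ h => Finset.sum_eq_zero fun b _ => by simp [h]) (by simp)]
  by_cases hc : c = c'
  · subst hc
    by_cases ha : a = a' <;> simp [ha, block, Matrix.sum_apply, Finset.sum_filter]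
  · have hne (b : B) : ¬ (R.f a b x y t = c ∧ R.f a b x y t = c') := fun h =>
      hc (h.1.symm.trans h.2)
    simp [hne, hc]

theorem sum_condOut [Fintype C] (k k' : e) :
    ∑ a, ∑ c, R.condOut x y t (a, c, k) (a, c, k') = ptraceAB R.σ k k' := by
  rw [← R.sum_block x y t]
  simp [condOut_apply, Matrix.sum_apply]

theorem condTest_eq_reindex_blockDiagonal :
    R.condTest c x y t = Matrix.reindex (Equiv.prodComm e A) (Equiv.prodComm e A)
      (Matrix.blockDiagonal (R.block c x y t)) := by
  ext ⟨a, k⟩ ⟨a', k'⟩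
  simp [condTest, condOut_apply, Matrix.blockDiagonal_apply]

theorem condTest_posSemidef : (R.condTest c x y t).PosSemidef := by
  rw [condTest_eq_reindex_blockDiagonal]
  exact (posSemidef_blockDiagonal (R.block_posSemidef c x y t)).submatrix _

theorem mpow_condTest (s : ℝ) :
    mpow (R.condTest c x y t) s = Matrix.reindex (Equiv.prodComm e A) (Equiv.prodComm e A)
      (Matrix.blockDiagonal fun a => mpow (R.block c x y t a) s) := by
  have hblock (a : A) : (R.block c x y t a).IsHermitian := (R.block_posSemidef c x y t a).1
  rw [condTest_eq_reindex_blockDiagonal, mpow,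
    cfc_reindex (Matrix.isHermitian_blockDiagonal_iff.2 hblock), cfc_blockDiagonal hblock]
  rfl

variable [DecidableEq X] [DecidableEq Y]

theorem out_apply (i j : A × C × e) (v v' : X × Y × Fin 2) :
    R.out (i, v) (j, v') =
      if v = v' then (R.P v.1 v.2.1 v.2.2 : ℂ) * R.condOut v.1 v.2.1 v.2.2 i j else 0 := by
  have hout : R.out (i, v) (j, v') = ∑ u : X × Y × Fin 2, (R.P u.1 u.2.1 u.2.2 •
      (R.condOut u.1 u.2.1 u.2.2 ⊗ₖ Matrix.single u u (1 : ℂ))) (i, v) (j, v') := by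
    simp only [out, Matrix.sum_apply, Fintype.sum_prod_type]
  rw [hout, Finset.sum_eq_single v (fun u _ hu => by simp [Matrix.kroneckerMap_apply, hu])
    (by simp)]
  simp [Matrix.kroneckerMap_apply, Matrix.single_apply]

theorem outTest_eq_reindex_blockDiagonal :
    R.outTest c = Matrix.reindex (Equiv.prodAssoc A e (X × Y × Fin 2))
      (Equiv.prodAssoc A e (X × Y × Fin 2)) (Matrix.blockDiagonal fun v : X × Y × Fin 2 =>
        R.P v.1 v.2.1 v.2.2 • R.condTest c v.1 v.2.1 v.2.2) := by
  ext ⟨a, k, v⟩ ⟨a', k', v'⟩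
  simp [outTest, out_apply, Matrix.blockDiagonal_apply, condTest]

theorem mpow_outTest (s : ℝ) :
    mpow (R.outTest c) s = Matrix.reindex (Equiv.prodAssoc A e (X × Y × Fin 2))
      (Equiv.prodAssoc A e (X × Y × Fin 2)) (Matrix.blockDiagonal fun v : X × Y × Fin 2 =>
        R.P v.1 v.2.1 v.2.2 ^ s • mpow (R.condTest c v.1 v.2.1 v.2.2) s) := by
  have hblock (v : X × Y × Fin 2) :
      (R.P v.1 v.2.1 v.2.2 • R.condTest c v.1 v.2.1 v.2.2).IsHermitian :=
    ((R.condTest_posSemidef c _ _ _).smul (R.P_nonneg _ _ _)).1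
  simp only [← mpow_smul (R.condTest_posSemidef c _ _ _) (R.P_nonneg _ _ _)]
  rw [outTest_eq_reindex_blockDiagonal, mpow,
    cfc_reindex (Matrix.isHermitian_blockDiagonal_iff.2 hblock), cfc_blockDiagonal hblock]
  rfl

variable [Fintype C]

theorem outE_eq_ptraceAB : R.outE = ptraceAB R.σ := by
  have hP : ∑ v : X × Y × Fin 2, (R.P v.1 v.2.1 v.2.2 : ℂ) = 1 := by
    simp only [Fintype.sum_prod_type]
    exact_mod_cast R.P_sum
  ext k k'
  calc R.outE k k' = ∑ u : A × C, ∑ v : X × Y × Fin 2,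
        (R.P v.1 v.2.1 v.2.2 : ℂ) * R.condOut v.1 v.2.1 v.2.2 (u.1, u.2, k) (u.1, u.2, k') := by
        simp only [outE, Matrix.of_apply, out_apply, if_true, Fintype.sum_prod_type]
    _ = ∑ v : X × Y × Fin 2, (R.P v.1 v.2.1 v.2.2 : ℂ) * ptraceAB R.σ k k' := by
        rw [Finset.sum_comm]
        simp only [← Finset.mul_sum, Fintype.sum_prod_type (γ := ℂ) (α₁ := A), sum_condOut]
    _ = ptraceAB R.σ k k' := by rw [← Finset.sum_mul, hP, one_mul]

theorem outXYTE_eq_blockDiagonal :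
    R.outXYTE = Matrix.blockDiagonal fun v : X × Y × Fin 2 => R.P v.1 v.2.1 v.2.2 • R.outE := by
  ext ⟨k, v⟩ ⟨k', v'⟩
  simp only [outXYTE, outE_eq_ptraceAB, Matrix.of_apply, out_apply, Matrix.blockDiagonal_apply]
  split_ifs
  · simp only [← Finset.mul_sum, sum_condOut, Matrix.smul_apply, Complex.real_smul]
  · simp only [Finset.sum_const_zero]

theorem mpow_outXYTE (s : ℝ) :
    mpow R.outXYTE s =
      Matrix.blockDiagonal fun v : X × Y × Fin 2 => R.P v.1 v.2.1 v.2.2 ^ s • mpow R.outE s := by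
  have hE : R.outE.PosSemidef := R.outE_eq_ptraceAB ▸ ptraceAB_posSemidef R.σ_posSemidef
  simp only [← mpow_smul hE (R.P_nonneg _ _ _)]
  rw [outXYTE_eq_blockDiagonal, mpow, cfc_blockDiagonal fun v => (hE.smul (R.P_nonneg _ _ _)).1]
  rfl

theorem one_kronecker_mpow_outXYTE (s : ℝ) :
    (1 : Matrix A A ℂ) ⊗ₖ mpow R.outXYTE s =
      Matrix.reindex (Equiv.prodAssoc A e (X × Y × Fin 2)) (Equiv.prodAssoc A e (X × Y × Fin 2))
        (Matrix.blockDiagonal fun v : X × Y × Fin 2 =>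
          R.P v.1 v.2.1 v.2.2 ^ s • ((1 : Matrix A A ℂ) ⊗ₖ mpow R.outE s)) := by
  rw [mpow_outXYTE]
  ext ⟨a, k, v⟩ ⟨a', k', v'⟩
  simp only [Matrix.kroneckerMap_apply, Matrix.blockDiagonal_apply, Matrix.reindex_apply,
    Matrix.submatrix_apply, Equiv.prodAssoc_symm_apply, Matrix.smul_apply, mul_ite, mul_zero,
    mul_smul_comm]

theorem condTerm_eq_sum_block (α : ℝ) : R.condTerm α c x y t =
    ∑ a, (mpow (R.block c x y t a) α * mpow (ptraceAB R.σ) (1 - α)).trace := by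
  rw [condTerm, outE_eq_ptraceAB, mpow_condTest, Matrix.one_kronecker,
    trace_reindex_blockDiagonal_mul]

theorem condTerm_eq_zero {α : ℝ} (hα : α ≠ 0) (h : ¬ 0 < R.probC c x y t) :
    R.condTerm α c x y t = 0 := by
  rw [condTerm_eq_sum_block]
  refine Finset.sum_eq_zero fun a _ => ?_
  rw [R.block_eq_zero_of_not_probC_pos c x y t a h, mpow_zero hα, zero_mul, Matrix.trace_zero]

theorem p_eq_sum_condTerm {α : ℝ} (hα : α ≠ 0) :
    R.p α c = ∑ v : X × Y × Fin 2 with 0 < R.probC c v.1 v.2.1 v.2.2,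
      (R.P v.1 v.2.1 v.2.2 : ℂ) * R.condTerm α c v.1 v.2.1 v.2.2 := by
  have hsum : R.p α c = ∑ v : X × Y × Fin 2,
      (R.P v.1 v.2.1 v.2.2 : ℂ) * R.condTerm α c v.1 v.2.1 v.2.2 := by
    rw [p, mpow_outTest, one_kronecker_mpow_outXYTE, trace_reindex_blockDiagonal_mul]
    refine Finset.sum_congr rfl fun v _ => ?_
    rw [smul_mul_smul_comm, Matrix.trace_smul, Complex.real_smul, condTerm,
      ← Real.rpow_add' (R.P_nonneg _ _ _) (by norm_num), add_sub_cancel, Real.rpow_one]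
  refine hsum.trans (Finset.sum_filter_of_ne fun v _ hv => ?_).symm
  contrapose! hv
  rw [R.condTerm_eq_zero c _ _ _ hα hv.not_gt, mul_zero]

theorem re_condTerm_le_objective {α : ℝ} (hα : α ≠ 0) {m : ℕ} {s w : Fin m → ℝ}
    {Z : A → Fin m → Matrix e e ℂ}
    (hZ : ∀ a, (mpow (R.block c x y t a) α * mpow (ptraceAB R.σ) (1 - α)).trace.re ≤
      (R.block c x y t a * polyP α s w (Z a)).trace.re +
        (ptraceAB R.σ * polyQ α w (Z a)).trace.re) :
    (R.condTerm α c x y t).re ≤ R.objective α s w c x y t Z := by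
  rw [condTerm_eq_sum_block, Complex.re_sum, objective_eq_sum_block,
    ← Finset.sum_filter_of_ne (p := fun a => 0 < R.probAgivenC a c x y t)]
  · exact Finset.sum_le_sum fun a _ => hZ a
  · intro a _ ha
    contrapose! ha
    rw [R.block_eq_zero_of_not_probAgivenC_pos c x y t a ha.not_gt, mpow_zero hα, zero_mul,
      Matrix.trace_zero, Complex.zero_re]

end SingleRound

end RenyiDI

end

theorem proposition5 (α : ℝ) (hα₁ : 1 < α) (hα₂ : α < 2) :
    (∀ {X Y A B C qA qB e : Type*} [Fintype X] [Fintype Y] [Fintype A] [Fintype B] [Fintype C]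
        [Fintype qA] [Fintype qB] [Fintype e] [DecidableEq X] [DecidableEq Y] [DecidableEq A]
        [DecidableEq C] [DecidableEq qA] [DecidableEq qB] [DecidableEq e]
        (R : RenyiDI.SingleRound X Y A B C qA qB e) (c : C),
      R.p α c = ∑ v : X × Y × Fin 2 with 0 < R.probC c v.1 v.2.1 v.2.2,
        (R.P v.1 v.2.1 v.2.2 : ℂ) * R.condTerm α c v.1 v.2.1 v.2.2) ∧
    ∀ m : ℕ, ∃ s w : Fin m → ℝ, (∀ i, s i ∈ Set.Ioc (0 : ℝ) 1) ∧ (∀ i, 0 < w i) ∧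
      ∀ {X Y A B C qA qB e : Type*} [Fintype X] [Fintype Y] [Fintype A] [Fintype B] [Fintype C]
        [Fintype qA] [Fintype qB] [Fintype e] [DecidableEq X] [DecidableEq Y] [DecidableEq A]
        [DecidableEq C] [DecidableEq qA] [DecidableEq qB] [DecidableEq e]
        (R : RenyiDI.SingleRound X Y A B C qA qB e) (c : C) (x : X) (y : Y) (t : Fin 2),
        BddAbove (Set.range (R.objective α s w c x y t)) ∧
          (R.condTerm α c x y t).re ≤ ⨆ Z : A → Fin m → Matrix e e ℂ,
            R.objective α s w c x y t Z := by
  have hα : α ∈ Set.Ioo (1 : ℝ) 2 := ⟨hα₁, hα₂⟩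
  have hα₀ : α ≠ 0 := by linarith
  refine ⟨fun R c => R.p_eq_sum_condTerm c hα₀, fun m => ?_⟩
  obtain ⟨s, w, hs, hw, hnodes⟩ := RenyiDI.exists_nodes_trace_mpow_mul_mpow_le hα m
  refine ⟨s, w, hs, hw, fun R c x y t => ?_⟩
  have hbdd := R.bddAbove_range_objective c x y t hα hs hw
  choose Z hZ using fun a => hnodes (R.block_posSemidef c x y t a)
    (RenyiDI.ptraceAB_posSemidef R.σ_posSemidef) (R.ptraceAB_sub_block_posSemidef c x y t a)
  exact ⟨hbdd, (R.re_condTerm_le_objective c x y t hα₀ hZ).trans (le_ciSup hbdd Z)⟩
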